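/- Let $(\Omega,\mu)$ be a probability space with $L_\infty(\Omega,\mu)\neq\mathbb C1$, i.e. there is a measurable set $X\subset\Omega$ with $0<\mu(X)<1$. Let $(T_t)_{t\ge 0}$, $T_t=e^{-tL}$, be an ergodic symmetric Markov semigroup on the complex space $L_\infty(\Omega,\mu)$: a weak-$*$ continuous semigroup of positive unital linear maps with $\int \bar f\,T_t g\,d\mu=\int \overline{T_tf}\,g\,d\mu$, whose only fixed points are the constants. Let $L$ be its generator, $Lf=w^*\text{-}\lim_{t\to0^+}\frac1t(f-T_tf)$ on the domain where this limit exists in $L_\infty$. Let $T_t$ and $L$ act entrywise on $\mathbb M_2$-valued functions. Write $\mathcal E(f,f)=\lim_{t\to 0^+}\frac1t\int\mathrm{tr}\big(f^*(f-T_tf)\big)d\mu\in[0,\infty]$ for the Dirichlet form on $L_\infty(\Omega,\mathbb M_2)$ and $\mathcal A_{\mathcal E}=\{f\in L_\infty(\Omega,\mathbb M_2):\mathcal E(f,f)<\infty\}$. Write $\mathrm{dom}(L)$ for the set of $f\in L_\infty(\Omega,\mathbb M_2)$ whose entries lie in the domain of $L$. Put $E_\mu(f)=\int f\,d\mu\in\mathbb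 M_2$, $\hat f=f-E_\mu(f)$, $|f|^2=f^*f$, $\|f\|_2^2=\int\mathrm{tr}(f^*f)\,d\mu$, and for bounded $g\ge0$ $$D(g\|E_\mu(g))=\int\mathrm{tr}\big(g\ln g-E_\mu(g)\ln E_\mu(g)\big)d\mu .$$ For $2\le p<\infty$ let $$\|f\|_{L_2(\mathbb M_2,L_p(\Omega))}=\inf\Big\{\|x^{-1}fy^{-1}\|_{L_p(\Omega,\mathbb M_2)} : x,y\in\mathbb M_2 \text{ positive invertible},\ \|x\|_{2r}=\|y\|_{2r}=1\Big\},\qquad \tfrac1r=\tfrac12-\tfrac1p,$$ be the norm of Pisier's vector-valued space, where $\|x\|_{2r}$ is the Schatten norm for the unnormalized trace, $\|f\|_{L_p(\Omega,\mathbb M_2)}=(\int\mathrm{tr}|f|^p\,d\mu)^{1/p}$, and $2r=\infty$ if $p=2$. Then $\|f\|_{L_2(\mathbb M_2,L_2(\Omega))}=\|f\|_2$. Let $\alpha_R$, $\alpha_2$, $\alpha_h$ be the largest real constants (with $\alpha_h\geq 0$) such that the following hold for all $f\in\mathcal A_{\mathcal E}$: $$\alpha_R\,D(|f|^2\|E_\mu(|f|^2))\le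 D(|\hat f|^2\|E_\mu(|\hat f|^2))+\|\hat f\|_2^2,\tag{Rothaus}$$ $$\alpha_2\,D(|f|^2\|E_\mu(|f|^2))\le 2\,\mathcal E(f,f),\tag{LSI}$$ $$\|T_tf\|_{L_2(\mathbb M_2,L_{p(t)}(\Omega))}\le\|f\|_{L_2(\mathbb M_2,L_2(\Omega))}\ \text{ for all } t\ge0,\quad p(t)=1+e^{2\alpha_ht}.\tag{HC}$$ Then these largest constants exist and $\alpha_R=\alpha_2=\alpha_h=0$. The same is true if the inequalities are only required for all $f\in \mathrm{dom}(L)$, where in (LSI) the right-hand side is replaced by $\int\mathrm{tr}(f^*Lf)\,d\mu$. -/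

import Mathlib

open MeasureTheory Filter Topology
open scoped ENNReal NNReal ComplexOrder Matrix

noncomputable section

namespace MatrixLSI

variable {Ω : Type*} [MeasurableSpace Ω]

/-- A symmetric (classical) Markov semigroup on the complex space `L_∞(Ω, μ)`: a weak-* continuous
semigroup of positive unital linear maps which are symmetric for `μ`.
(On a commutative algebra positive maps are completely positive, and the symmetry makes each
`T t` the dual of a map on `L_1`, so normality is automatic.) -/
structure SymmetricMarkovSemigroup (μ : Measure Ω) [IsProbabilityMeasure μ] where
  /-- the map at time `t` -/
  T : ℝ≥0 → Lp ℂ ∞ μ →ₗ[ℂ] Lp ℂ ∞ μ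
  map_zero : T 0 = LinearMap.id
  map_add : ∀ s t, T (s + t) = T s ∘ₗ T t
  unital : ∀ t, T t (Lp.const ∞ μ 1) = Lp.const ∞ μ 1
  positive : ∀ t (f : Lp ℂ ∞ μ), (∀ᵐ ω ∂μ, 0 ≤ f ω) → ∀ᵐ ω ∂μ, 0 ≤ T t f ω
  symmetric : ∀ t (f g : Lp ℂ ∞ μ), ∫ ω, star (f ω) * T t g ω ∂μ = ∫ ω, star (T t f ω) * g ω ∂μ
  continuous_weakStar : ∀ (f : Lp ℂ ∞ μ) (g : Lp ℂ 1 μ), Continuous fun t => ∫ ω, g ω * T t f ω ∂μ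

/-- The space `L_∞(Ω, M_2)`, as `M_2(L_∞(Ω))`. -/
abbrev MatLinf (μ : Measure Ω) : Type _ := Matrix (Fin 2) (Fin 2) (Lp ℂ ∞ μ)

/-- The matrix-valued function given by an element of `L_∞(Ω, M_2)`. -/
def MatLinf.toFun {μ : Measure Ω} (f : MatLinf μ) (ω : Ω) : Matrix (Fin 2) (Fin 2) ℂ :=
  Matrix.of fun i j => f i j ω

/-- The squared modulus `|F|² = F* F`, pointwise. -/
def sqAbs (F : Ω → Matrix (Fin 2) (Fin 2) ℂ) (ω : Ω) : Matrix (Fin 2) (Fin 2) ℂ := (F ω)ᴴ * F ω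

/-- The matrix-valued mean `E_μ(F) = ∫ F dμ`, taken entrywise. -/
def matMean (μ : Measure Ω) (F : Ω → Matrix (Fin 2) (Fin 2) ℂ) : Matrix (Fin 2) (Fin 2) ℂ :=
  Matrix.of fun i j => ∫ ω, F ω i j ∂μ

/-- `tr (A ln A)` for a positive semidefinite matrix `A`, with `0 ln 0 = 0`. -/
def trLog (A : Matrix (Fin 2) (Fin 2) ℂ) : ℝ := (A * cfc Real.log A).trace.re

/-- `μ ∘ tr (G ln G - E_μ(G) ln E_μ(G))`, which is the relative entropy `D(G ‖ E_μ(G))`,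
for a bounded function `G` with positive semidefinite values. -/
def matEnt (μ : Measure Ω) (G : Ω → Matrix (Fin 2) (Fin 2) ℂ) : ℝ :=
  ∫ ω, trLog (G ω) ∂μ - trLog (matMean μ G)

/-- The mean zero part of `F`. -/
def centered (μ : Measure Ω) (F : Ω → Matrix (Fin 2) (Fin 2) ℂ) (ω : Ω) :
    Matrix (Fin 2) (Fin 2) ℂ := F ω - matMean μ F

/-- `‖F‖_2² = μ ∘ tr (F* F)`. -/
def normSqL2 (μ : Measure Ω) (F : Ω → Matrix (Fin 2) (Fin 2) ℂ) : ℝ :=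
  ∫ ω, ((F ω)ᴴ * F ω).trace.re ∂μ

/-- The Schatten `p`-norm on `M_2` for the unnormalized trace:
the `ℓ_p` norm of the singular values. -/
def schattenNorm (p : ℝ≥0∞) (A : Matrix (Fin 2) (Fin 2) ℂ) : ℝ :=
  ‖WithLp.toLp p fun i : Fin 2 =>
    √((Matrix.isHermitian_conjTranspose_mul_self A).eigenvalues i)‖

/-- The norm of `L_p(Ω, M_2) = L_p(M_2, L_p(Ω))`, that is `(∫ tr |F|^p dμ)^{1/p}`. -/
def matLpNorm (μ : Measure Ω) (p : ℝ≥0∞) (F : Ω → Matrix (Fin 2) (Fin 2) ℂ) : ℝ≥0∞ :=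
  eLpNorm (fun ω => schattenNorm p (F ω)) p μ

/-- For `2 ≤ p < ∞`, the exponent `2r ∈ (2, ∞]` with `1/r = 1/2 - 1/p` (so `2r = ∞` for `p = 2`). -/
def pisierExponent (p : ℝ) : ℝ≥0∞ := (ENNReal.ofReal ((1 / 2 - 1 / p) / 2))⁻¹

/-- The norm of Pisier's space `L_2(M_2, L_p(Ω))` for `2 ≤ p < ∞`:
the infimum of `‖x⁻¹ F y⁻¹‖_{L_p(Ω, M_2)}` over positive invertible `x, y ∈ M_2` of unit
`2r`-norm, where `1/r = 1/2 - 1/p`. -/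
def pisierNorm (μ : Measure Ω) (p : ℝ) (F : Ω → Matrix (Fin 2) (Fin 2) ℂ) : ℝ≥0∞ :=
  ⨅ (x : Matrix (Fin 2) (Fin 2) ℂ) (y : Matrix (Fin 2) (Fin 2) ℂ)
    (_ : x.PosDef ∧ schattenNorm (pisierExponent p) x = 1)
    (_ : y.PosDef ∧ schattenNorm (pisierExponent p) y = 1),
    matLpNorm μ (ENNReal.ofReal p) fun ω => x⁻¹ * F ω * y⁻¹

namespace SymmetricMarkovSemigroup

variable {μ : Measure Ω} [IsProbabilityMeasure μ] (S : SymmetricMarkovSemigroup μ)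

/-- Ergodicity: the fixed points of the semigroup are the constants. -/
def IsErgodic : Prop :=
  ∀ f : Lp ℂ ∞ μ, (∀ t, S.T t f = f) → ∃ c : ℂ, f = Lp.const ∞ μ c

/-- The amplification `T_t ⊗ id` on `L_∞(Ω, M_2)`, acting entrywise. -/
def amp (t : ℝ≥0) (f : MatLinf μ) : MatLinf μ := f.map (S.T t)

/-- `g = L f`, where `L` is the generator: `(f - T_t f)/t → g` weak-* in `L_∞` as `t → 0+`. -/
def IsGenerator (f g : Lp ℂ ∞ μ) : Prop :=
  ∀ h : Lp ℂ 1 μ, Tendsto (fun t : ℝ≥0 => ((t : ℝ) : ℂ)⁻¹ * ∫ ω, h ω * (f ω - S.T t f ω) ∂μ)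
    (𝓝[>] 0) (𝓝 (∫ ω, h ω * g ω ∂μ))

/-- `g = (L ⊗ id) f` for matrix-valued functions. -/
def IsMatGenerator (f g : MatLinf μ) : Prop := ∀ i j, S.IsGenerator (f i j) (g i j)

/-- The domain of `L ⊗ id` in `L_∞(Ω, M_2)`. -/
def matDom : Set (MatLinf μ) := {f | ∃ g, S.IsMatGenerator f g}

/-- The Dirichlet form `ℰ(f, f) ∈ [0, ∞]` of `L ⊗ id`: the (monotone) limit, as `t → 0+`, of
`μ ∘ tr (f* (f - T_t f)) / t`. -/
def energy (f : MatLinf μ) : ℝ≥0∞ :=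
  ⨆ (t : ℝ≥0) (_ : 0 < t), ENNReal.ofReal
    ((t : ℝ)⁻¹ * (∫ ω, ((f.toFun ω)ᴴ * (f.toFun ω - (S.amp t f).toFun ω)).trace ∂μ).re)

/-- The Dirichlet algebra `dom(ℰ) ∩ L_∞(Ω, M_2)`. -/
def dirichletAlgebra : Set (MatLinf μ) := {f | S.energy f < ∞}

/-- The matrix-valued Rothaus inequality with constant `α`, on a class `C` of functions. -/
def Rothaus (_S : SymmetricMarkovSemigroup μ) (C : Set (MatLinf μ)) (α : ℝ) : Prop :=
  ∀ f ∈ C, α * matEnt μ (sqAbs f.toFun) ≤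
    matEnt μ (sqAbs (centered μ f.toFun)) + normSqL2 μ (centered μ f.toFun)

/-- The matrix-valued log-Sobolev inequality, for `f` in the Dirichlet algebra and with
the Dirichlet form on the right-hand side. -/
def LogSobolevForm (α : ℝ) : Prop :=
  ∀ f ∈ S.dirichletAlgebra, α * matEnt μ (sqAbs f.toFun) ≤ 2 * (S.energy f).toReal

/-- The matrix-valued log-Sobolev inequality, for `f` in the domain of the generator and with
`μ ∘ tr (f* (L ⊗ id) f)` on the right-hand side. -/
def LogSobolevGen (α : ℝ) : Prop :=
  ∀ f g : MatLinf μ, S.IsMatGenerator f g →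
    α * matEnt μ (sqAbs f.toFun) ≤ (∫ ω, ((f.toFun ω)ᴴ * g.toFun ω).trace ∂μ).re

/-- Hypercontractivity with constant `α ≥ 0`, on a class `C` of functions:
`‖T_t f‖_{L_2(M_2, L_{p(t)}(Ω))} ≤ ‖f‖_{L_2(M_2, L_2(Ω))}` for `p(t) = 1 + e^{2αt}`, `t ≥ 0`. -/
def Hypercontractive (C : Set (MatLinf μ)) (α : ℝ) : Prop :=
  0 ≤ α ∧ ∀ f ∈ C, ∀ t : ℝ≥0,
    pisierNorm μ (1 + Real.exp (2 * α * t)) (S.amp t f).toFun ≤ matLpNorm μ 2 f.toFun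

end SymmetricMarkovSemigroup

end MatrixLSI

end

noncomputable section

namespace MatrixLSI

/-! ### Pointwise bounds and integrability for bounded functions -/

section LInfty

variable {Ω : Type*} [MeasurableSpace Ω] {μ : Measure Ω}

/-! One family of test functions defeats all three inequalities: `f = e₁₁ + ε u e₁₂` with `u`
bounded, nonzero, of mean zero and in the domain of the generator. Write `s = ∫ |u|²`.

Pointwise `|f|²` has rank one, with eigenvalue `1 + ε²|u|² ≥ 1`, so `∫ tr (|f|² ln |f|²) ≥ 0`. Its
mean is `diag(1, ε² s)`, because the off-diagonal entries average out. The entropy of `|f|²` is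
therefore at least `-ε² s ln (ε² s)`, which is of order `ε² ln (1/ε²)`. Centering `f` removes the
constant corner and leaves `ε u e₁₂`, so the right side of Rothaus is at most a constant times `ε²`,
and so is the energy. Letting `ε → 0` gives `α ≤ 0` (`nonpos_of_forall_mul_neg_mul_log_le`).

For hypercontractivity, suppose `α > 0`, so that `p(t) > 2` and `r < ∞` for `t > 0`. Since `f` has
rank one, the norm of `x⁻¹ f y⁻¹` in `L_p` dominates its norm in `L_2`, whose square is `(x⁻²)₁₁ tr
(ρ y⁻²)` with `ρ = diag(1, ε² s)`. Here `(x⁻²)₁₁ ≥ 1`. Keeping `(y⁻²)₂₂` bounded forces `(y⁻²)₁₁` to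
exceed `1` by a fixed amount, so for every `K` the squared Pisier norm is at least `1 + min (K ε² s)
η` (`exists_gap`). Applied to `T_t u`, this beats `‖f‖_2² = 1 + ε² ∫ |u|²` once `K` is large.

A suitable `u` is the weak-* average `∫₀¹ T_s k ds` of the centered indicator `k` of `X`; the same
`u` serves both classes of functions. That the constant `0` is admissible follows from Jensen's
inequality for `tr (A ln A)`, positivity of the generator, and contractivity of `T_t` on `L_2`. -/

theorem ae_norm_le_norm (f : Lp ℂ ∞ μ) : ∀ᵐ ω ∂μ, ‖f ω‖ ≤ ‖f‖ := by
  have h := ae_le_eLpNormEssSup (f := f) (μ := μ)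
  filter_upwards [h] with ω hω
  rw [Lp.norm_def, eLpNorm_exponent_top]
  have h2 : eLpNormEssSup f μ ≠ ∞ := by
    rw [← eLpNorm_exponent_top]; exact Lp.eLpNorm_ne_top f
  have := (ENNReal.toReal_le_toReal (by simp) h2).2 hω
  simpa using this

theorem aesm (f : Lp ℂ ∞ μ) : AEStronglyMeasurable f μ := Lp.aestronglyMeasurable f

theorem integrable_mul_linf {h : Ω → ℂ} (hh : Integrable h μ) (f : Lp ℂ ∞ μ) :
    Integrable (fun ω => h ω * f ω) μ :=
  hh.mul_bdd (aesm f) (ae_norm_le_norm f)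

theorem integrable_linf [IsFiniteMeasure μ] (f : Lp ℂ ∞ μ) : Integrable f μ :=
  ((Lp.memLp f).mono_exponent le_top : MemLp f 1 μ).integrable le_rfl

theorem integrable_star_mul [IsFiniteMeasure μ] (f g : Lp ℂ ∞ μ) :
    Integrable (fun ω => star (f ω) * g ω) μ := by
  refine integrable_mul_linf ?_ g
  have := integrable_linf (star f)
  exact this.congr (Lp.coeFn_star f)

theorem integrable_norm_sq [IsFiniteMeasure μ] (f : Lp ℂ ∞ μ) :
    Integrable (fun ω => ‖f ω‖ ^ 2) μ :=
  ((Lp.memLp f).mono_exponent le_top : MemLp f 2 μ).integrable_norm_pow (by norm_num)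

theorem const_eq_smul [IsFiniteMeasure μ] (c : ℂ) :
    Lp.const ∞ μ c = c • Lp.const ∞ μ (1 : ℂ) := by
  have := (Lp.constₗ ∞ μ ℂ).map_smul c (1 : ℂ)
  simpa using this

theorem memLp_sqModulus (f : Lp ℂ ∞ μ) : MemLp (fun ω => ((‖f ω‖ ^ 2 : ℝ) : ℂ)) ∞ μ := by
  refine memLp_top_of_bound ?_ (‖f‖ ^ 2) ?_
  · exact Complex.continuous_ofReal.comp_aestronglyMeasurable ((aesm f).norm.pow 2)
  · filter_upwards [ae_norm_le_norm f] with ω hω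
    rw [Complex.norm_real, norm_pow, norm_norm]
    gcongr

/-- Here `m`, `a`, `b` play the roles of `T|f|²`, `Tf`, `T f̄` at one point, and the expression is
`T|f - c|²`. A dense sequence, rather than all `c`, keeps the exceptional null set countable. By
continuity every `z` is allowed: `z = 0, 1, i` force `b = ā` through imaginary parts, and `z = a` is
the optimal choice for the inequality. -/
theorem eq_conj_and_norm_sq_le {m a b : ℂ} {c : ℕ → ℂ} (hc : DenseRange c)
    (h : ∀ n, 0 ≤ m - star (c n) * a - c n * b + ((‖c n‖ ^ 2 : ℝ) : ℂ)) :
    b = star a ∧ ‖a‖ ^ 2 ≤ m.re := by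
  have key : ∀ z : ℂ, 0 ≤ m - star z * a - z * b + ((‖z‖ ^ 2 : ℝ) : ℂ) := by
    intro z
    refine hc.induction_on z ?_ h
    exact isClosed_Ici.preimage (f := fun z : ℂ => m - star z * a - z * b + ((‖z‖ ^ 2 : ℝ) : ℂ))
      (by fun_prop)
  have h0 := key 0
  have h1 := key 1
  have hI := key Complex.I
  simp [Complex.le_def] at h0 h1 hI
  have hb : b = star a := by
    apply Complex.ext
    · simp; linarith [hI.2]
    · simp; linarith [h1.2]
  refine ⟨hb, ?_⟩
  have h2 := (Complex.le_def.1 (key a)).1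
  rw [hb] at h2
  rw [← Complex.normSq_eq_norm_sq] at h2 ⊢
  simp [Complex.normSq_apply] at h2 ⊢
  linarith

end LInfty

/-! ### Reality, contractivity and symmetry of the semigroup -/

namespace SymmetricMarkovSemigroup

variable {Ω : Type*} [MeasurableSpace Ω] {μ : Measure Ω} [IsProbabilityMeasure μ]
  (S : SymmetricMarkovSemigroup μ)

theorem T_const (t : ℝ≥0) (c : ℂ) : S.T t (Lp.const ∞ μ c) = Lp.const ∞ μ c := by
  rw [const_eq_smul, map_smul, S.unital]

/-- Positivity yields reality and the Kadison–Schwarz inequality. -/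
theorem kadison (t : ℝ≥0) (f : Lp ℂ ∞ μ) :
    ∀ᵐ ω ∂μ, S.T t (star f) ω = star (S.T t f ω) ∧
      ‖S.T t f ω‖ ^ 2 ≤ (S.T t ((memLp_sqModulus f).toLp _) ω).re := by
  let c := TopologicalSpace.denseSeq ℂ
  let q : Lp ℂ ∞ μ := (memLp_sqModulus f).toLp _
  have hq : ∀ n, ∀ᵐ ω ∂μ,
      0 ≤ S.T t q ω - star (c n) * S.T t f ω - c n * S.T t (star f) ω
        + ((‖c n‖ ^ 2 : ℝ) : ℂ) := by
    intro n
    have hpos := S.positive t (q - star (c n) • f - c n • star f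
      + Lp.const ∞ μ ((‖c n‖ ^ 2 : ℝ) : ℂ)) (by
        filter_upwards [Lp.coeFn_add (q - star (c n) • f - c n • star f)
          (Lp.const ∞ μ ((‖c n‖ ^ 2 : ℝ) : ℂ)), Lp.coeFn_sub (q - star (c n) • f) (c n • star f),
          Lp.coeFn_sub q (star (c n) • f), Lp.coeFn_smul (star (c n)) f,
          Lp.coeFn_smul (c n) (star f), Lp.coeFn_star f,
          Lp.coeFn_const ∞ μ ((‖c n‖ ^ 2 : ℝ) : ℂ), (memLp_sqModulus f).coeFn_toLp]
          with ω h1 h2 h3 h4 h5 h6 h7 h8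
        rw [h1, Pi.add_apply, h2, Pi.sub_apply, h3, Pi.sub_apply, h4, h5, Pi.smul_apply,
          Pi.smul_apply, h6, h7, h8]
        have : ((‖f ω‖ ^ 2 : ℝ) : ℂ) - star (c n) • f ω - c n • (star (f : Ω → ℂ)) ω
            + Function.const Ω ((‖c n‖ ^ 2 : ℝ) : ℂ) ω = ((‖f ω - c n‖ ^ 2 : ℝ) : ℂ) := by
          simp only [← Complex.normSq_eq_norm_sq]
          simp only [Complex.normSq_eq_conj_mul_self, Function.const_apply, Pi.star_apply,
            smul_eq_mul, Complex.star_def, map_sub]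
          ring
        rw [this]
        exact Complex.zero_le_real.2 (sq_nonneg _))
    rw [_root_.map_add, map_sub, map_sub, map_smul, map_smul, S.T_const] at hpos
    filter_upwards [hpos, Lp.coeFn_add (S.T t q - star (c n) • S.T t f - c n • S.T t (star f))
          (Lp.const ∞ μ ((‖c n‖ ^ 2 : ℝ) : ℂ)),
          Lp.coeFn_sub (S.T t q - star (c n) • S.T t f) (c n • S.T t (star f)),
          Lp.coeFn_sub (S.T t q) (star (c n) • S.T t f), Lp.coeFn_smul (star (c n)) (S.T t f),
          Lp.coeFn_smul (c n) (S.T t (star f)),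
          Lp.coeFn_const ∞ μ ((‖c n‖ ^ 2 : ℝ) : ℂ)] with ω h0 h1 h2 h3 h4 h5 h7
    rw [h1, Pi.add_apply, h2, Pi.sub_apply, h3, Pi.sub_apply, h4, h5, Pi.smul_apply,
      Pi.smul_apply, h7] at h0
    simpa only [smul_eq_mul, Function.const_apply] using h0
  filter_upwards [ae_all_iff.2 hq] with ω hω
  exact eq_conj_and_norm_sq_le (TopologicalSpace.denseRange_denseSeq ℂ) hω

theorem T_star (t : ℝ≥0) (f : Lp ℂ ∞ μ) : S.T t (star f) = star (S.T t f) := by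
  apply Lp.ext
  filter_upwards [S.kadison t f, Lp.coeFn_star (S.T t f)] with ω h1 h2
  rw [h1.1, h2, Pi.star_apply]

theorem integral_T (t : ℝ≥0) (f : Lp ℂ ∞ μ) : ∫ ω, S.T t f ω ∂μ = ∫ ω, f ω ∂μ := by
  have h := S.symmetric t (Lp.const ∞ μ 1) f
  rw [S.unital] at h
  have h1 : ∀ g : Lp ℂ ∞ μ, ∫ ω, star (Lp.const ∞ μ (1 : ℂ) ω) * g ω ∂μ = ∫ ω, g ω ∂μ := by
    intro g
    refine integral_congr_ae ?_
    filter_upwards [Lp.coeFn_const ∞ μ (1 : ℂ)] with ω hω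
    rw [hω]; simp
  rwa [h1, h1] at h

theorem integral_T_sq_le (t : ℝ≥0) (f : Lp ℂ ∞ μ) :
    ∫ ω, ‖S.T t f ω‖ ^ 2 ∂μ ≤ ∫ ω, ‖f ω‖ ^ 2 ∂μ := by
  have h2 := S.integral_T t ((memLp_sqModulus f).toLp _)
  have h3 : ∫ ω, (memLp_sqModulus f).toLp _ ω ∂μ = ((∫ ω, ‖f ω‖ ^ 2 ∂μ : ℝ) : ℂ) := by
    rw [← integral_complex_ofReal]
    exact integral_congr_ae (memLp_sqModulus f).coeFn_toLp
  have hi := integrable_linf (S.T t ((memLp_sqModulus f).toLp _))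
  calc ∫ ω, ‖S.T t f ω‖ ^ 2 ∂μ
      ≤ ∫ ω, (S.T t ((memLp_sqModulus f).toLp _) ω).re ∂μ := by
        refine integral_mono_ae (integrable_norm_sq _) hi.re ?_
        filter_upwards [S.kadison t f] with ω h using h.2
    _ = (∫ ω, S.T t ((memLp_sqModulus f).toLp _) ω ∂μ).re := integral_re hi
    _ = ∫ ω, ‖f ω‖ ^ 2 ∂μ := by rw [h2, h3, Complex.ofReal_re]

/-- Kadison–Schwarz followed by positivity on `‖f‖² - |f|²`: `|T f|² ≤ T|f|² ≤ ‖f‖²`. -/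
theorem ae_norm_T_le (t : ℝ≥0) (f : Lp ℂ ∞ μ) : ∀ᵐ ω ∂μ, ‖S.T t f ω‖ ≤ ‖f‖ := by
  let q : Lp ℂ ∞ μ := (memLp_sqModulus f).toLp _
  have hpos := S.positive t (Lp.const ∞ μ ((‖f‖ ^ 2 : ℝ) : ℂ) - q) (by
    filter_upwards [Lp.coeFn_sub (Lp.const ∞ μ ((‖f‖ ^ 2 : ℝ) : ℂ)) q, ae_norm_le_norm f,
      (memLp_sqModulus f).coeFn_toLp, Lp.coeFn_const ∞ μ ((‖f‖ ^ 2 : ℝ) : ℂ)] with ω h1 h2 h3 h4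
    rw [h1, Pi.sub_apply, h3, h4, Function.const_apply, sub_nonneg]
    have : ‖f ω‖ ^ 2 ≤ ‖f‖ ^ 2 := by gcongr
    exact_mod_cast this)
  rw [map_sub, S.T_const] at hpos
  filter_upwards [hpos, S.kadison t f, Lp.coeFn_const ∞ μ ((‖f‖ ^ 2 : ℝ) : ℂ),
    Lp.coeFn_sub (Lp.const ∞ μ ((‖f‖ ^ 2 : ℝ) : ℂ)) (S.T t q)] with ω h1 h2 h3 h4
  rw [h4, Pi.sub_apply, h3, Function.const_apply] at h1
  have h5 := (Complex.le_def.1 h1).1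
  rw [Complex.sub_re, Complex.ofReal_re, Complex.zero_re] at h5
  refine le_of_sq_le_sq ?_ (norm_nonneg _)
  linarith [h2.2]

/-- Symmetry for the bilinear pairing. -/
theorem symmetric_bilin (t : ℝ≥0) (h f : Lp ℂ ∞ μ) :
    ∫ ω, h ω * S.T t f ω ∂μ = ∫ ω, S.T t h ω * f ω ∂μ := by
  have h1 := S.symmetric t (star h) f
  rw [S.T_star] at h1
  have h2 : ∀ k g : Lp ℂ ∞ μ, ∫ ω, star (star k ω) * g ω ∂μ = ∫ ω, k ω * g ω ∂μ := by
    intro k g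
    refine integral_congr_ae ?_
    filter_upwards [Lp.coeFn_star k] with ω hω
    rw [hω, Pi.star_apply, star_star]
  have h3 : ∫ ω, star ((star h : Lp ℂ ∞ μ) ω) * S.T t f ω ∂μ = ∫ ω, h ω * S.T t f ω ∂μ := h2 _ _
  have h4 : ∫ ω, star ((star (S.T t h) : Lp ℂ ∞ μ) ω) * f ω ∂μ = ∫ ω, S.T t h ω * f ω ∂μ := h2 _ _
  rw [← h3, ← h4, h1]

theorem continuous_pairing (f : Lp ℂ ∞ μ) {h : Ω → ℂ} (hh : Integrable h μ) :
    Continuous fun t : ℝ≥0 => ∫ ω, h ω * S.T t f ω ∂μ := by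
  have := S.continuous_weakStar f hh.toL1
  convert this using 2 with t
  refine integral_congr_ae ?_
  filter_upwards [hh.coeFn_toL1] with ω hω
  rw [hω]

/-- The orbit `s ↦ ∫ h T_s f dμ`. -/
def orbit (f : Lp ℂ ∞ μ) (h : Ω → ℂ) (s : ℝ) : ℂ := ∫ ω, h ω * S.T s.toNNReal f ω ∂μ

/-- Negative times are truncated to `0`, so the orbit is continuous on all of `ℝ` and the
fundamental theorem of calculus holds two-sidedly at `0`. -/
theorem continuous_orbit (f : Lp ℂ ∞ μ) {h : Ω → ℂ} (hh : Integrable h μ) :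
    Continuous (S.orbit f h) :=
  (S.continuous_pairing f hh).comp continuous_real_toNNReal

theorem norm_orbit_le (f : Lp ℂ ∞ μ) {h : Ω → ℂ} (hh : Integrable h μ) (s : ℝ) :
    ‖S.orbit f h s‖ ≤ ‖f‖ * ∫ ω, ‖h ω‖ ∂μ := by
  rw [orbit, ← integral_const_mul]
  refine norm_integral_le_of_norm_le (hh.norm.const_mul _) ?_
  filter_upwards [S.ae_norm_T_le s.toNNReal f] with ω hω
  rw [norm_mul, mul_comm]
  gcongr

end SymmetricMarkovSemigroup

/-! ### Weak-* averages of orbits and the domain of the generator -/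

/-- A functional on `L_2` which is bounded for the `L_1` norm is given by a bounded function. -/
theorem exists_linf_of_functional {Ω : Type*} [MeasurableSpace Ω] {μ : Measure Ω}
    [IsProbabilityMeasure μ] (Λ : Lp ℂ 2 μ →L[ℂ] ℂ) (C : ℝ)
    (hΛ : ∀ h : Lp ℂ 2 μ, ‖Λ h‖ ≤ C * ∫ ω, ‖h ω‖ ∂μ) :
    ∃ u : Lp ℂ ∞ μ, ∀ h : Lp ℂ 2 μ, ∫ ω, h ω * u ω ∂μ = Λ h := by
  let v : Lp ℂ 2 μ := (InnerProductSpace.toDual ℂ _).symm Λ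
  have hv : ∀ h : Lp ℂ 2 μ, ∫ ω, h ω * star (v ω) ∂μ = Λ h := by
    intro h
    rw [← InnerProductSpace.toDual_symm_apply (x := h) (y := Λ), L2.inner_def]
    simp [v]
  have hvi : Integrable v μ := (Lp.memLp v).integrable (by norm_num)
  have hvm : StronglyMeasurable v := Lp.stronglyMeasurable v
  have hbound : ∀ᵐ ω ∂μ, ‖v ω‖ ≤ C := by
    refine ae_le_of_forall_setIntegral_le hvi.norm (integrable_const C) ?_
    intro s hs _
    -- Testing against the phase of `v` on `s` turns the `L_1` bound into `∫_s |v| ≤ C μ(s)`. Where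
    -- `v = 0` the convention `0⁻¹ = 0` makes `k` vanish.
    let k : Ω → ℂ := s.indicator fun ω => v ω * ((‖v ω‖⁻¹ : ℝ) : ℂ)
    have hkm : StronglyMeasurable k :=
      (hvm.mul (Complex.measurable_ofReal.comp hvm.norm.measurable.inv).stronglyMeasurable).indicator
        hs
    have hkb : ∀ ω, ‖k ω‖ ≤ s.indicator 1 ω := by
      intro ω
      by_cases h : ω ∈ s
      · simp only [k, Set.indicator_of_mem h, norm_mul, Complex.norm_real, norm_inv, norm_norm,
          Pi.one_apply]
        exact mul_inv_le_one
      · simp [k, h]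
    have hk2 : MemLp k 2 μ := by
      refine MemLp.of_bound hkm.aestronglyMeasurable 1 (ae_of_all _ fun ω => (hkb ω).trans ?_)
      exact Set.indicator_le_self' (by simp) ω
    have h1 : Λ (hk2.toLp k) = ((∫ ω in s, ‖v ω‖ ∂μ : ℝ) : ℂ) := by
      rw [← hv, ← integral_complex_ofReal, ← integral_indicator hs]
      refine integral_congr_ae ?_
      filter_upwards [hk2.coeFn_toLp] with ω hω
      rw [hω]
      by_cases h : ω ∈ s
      · simp only [k, Set.indicator_of_mem h, Complex.star_def]
        rw [mul_right_comm, Complex.mul_conj, Complex.normSq_eq_norm_sq]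
        norm_cast
        by_cases h0 : ‖v ω‖ = 0
        · simp [h0]
        · field_simp
      · simp [k, h]
    have hC : 0 ≤ C := by
      have h2 := hΛ ((memLp_const (1 : ℂ)).toLp _)
      have h3 : ∫ ω, ‖(memLp_const (1 : ℂ) : MemLp _ 2 μ).toLp _ ω‖ ∂μ = 1 := by
        have : ∫ ω, ‖(memLp_const (1 : ℂ) : MemLp _ 2 μ).toLp _ ω‖ ∂μ = ∫ _, (1 : ℝ) ∂μ := by
          refine integral_congr_ae ?_
          filter_upwards [(memLp_const (1 : ℂ) : MemLp _ 2 μ).coeFn_toLp] with ω hω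
          rw [hω]; simp
        rw [this]; simp
      rw [h3, mul_one] at h2
      exact (norm_nonneg _).trans h2
    have h4 := hΛ (hk2.toLp k)
    rw [h1, Complex.norm_real, Real.norm_of_nonneg (by positivity)] at h4
    refine h4.trans ?_
    rw [setIntegral_const, smul_eq_mul, mul_comm]
    gcongr
    calc ∫ ω, ‖hk2.toLp k ω‖ ∂μ ≤ ∫ ω, s.indicator 1 ω ∂μ := by
          refine integral_mono_ae ((Lp.memLp _).integrable (by norm_num)).norm
            ((integrable_const (1 : ℝ)).indicator hs) ?_
          filter_upwards [hk2.coeFn_toLp] with ω hω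
          rw [hω]; exact hkb ω
      _ = μ.real s := integral_indicator_one hs
  have hmem : MemLp (fun ω => star (v ω)) ∞ μ :=
    memLp_top_of_bound (continuous_star.comp_aestronglyMeasurable hvm.aestronglyMeasurable) C
      (by filter_upwards [hbound] with ω hω; rwa [norm_star])
  refine ⟨hmem.toLp _, fun h => ?_⟩
  rw [← hv]
  refine integral_congr_ae ?_
  filter_upwards [hmem.coeFn_toLp] with ω hω
  rw [hω]

namespace SymmetricMarkovSemigroup

variable {Ω : Type*} [MeasurableSpace Ω] {μ : Measure Ω} [IsProbabilityMeasure μ]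
  (S : SymmetricMarkovSemigroup μ)

theorem orbit_add (f : Lp ℂ ∞ μ) {h k : Ω → ℂ} (hh : Integrable h μ) (hk : Integrable k μ) (s : ℝ) :
    S.orbit f (h + k) s = S.orbit f h s + S.orbit f k s := by
  rw [orbit, orbit, orbit, ← integral_add (integrable_mul_linf hh _) (integrable_mul_linf hk _)]
  simp only [Pi.add_apply, add_mul]

theorem orbit_sub (f : Lp ℂ ∞ μ) {h k : Ω → ℂ} (hh : Integrable h μ) (hk : Integrable k μ) (s : ℝ) :
    S.orbit f (h - k) s = S.orbit f h s - S.orbit f k s := by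
  rw [orbit, orbit, orbit, ← integral_sub (integrable_mul_linf hh _) (integrable_mul_linf hk _)]
  simp only [Pi.sub_apply, sub_mul]

theorem orbit_smul (f : Lp ℂ ∞ μ) (c : ℂ) (h : Ω → ℂ) (s : ℝ) :
    S.orbit f (c • h) s = c * S.orbit f h s := by
  rw [orbit, orbit, ← integral_const_mul]
  simp only [Pi.smul_apply, smul_eq_mul, mul_assoc]

theorem orbit_congr (f : Lp ℂ ∞ μ) {h k : Ω → ℂ} (hhk : h =ᵐ[μ] k) : S.orbit f h = S.orbit f k := by
  ext s
  refine integral_congr_ae ?_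
  filter_upwards [hhk] with ω hω
  rw [hω]

theorem norm_integral_orbit_le (f : Lp ℂ ∞ μ) {h : Ω → ℂ} (hh : Integrable h μ) (a b : ℝ) :
    ‖∫ s in a..b, S.orbit f h s‖ ≤ ‖f‖ * (∫ ω, ‖h ω‖ ∂μ) * |b - a| :=
  intervalIntegral.norm_integral_le_of_norm_le_const fun s _ => S.norm_orbit_le f hh s

/-- The average of the orbit of `f` over the unit interval, weak-* in `L_∞`. -/
theorem exists_average (f : Lp ℂ ∞ μ) : ∃ u : Lp ℂ ∞ μ, ∀ h : Lp ℂ ∞ μ,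
    ∫ ω, h ω * u ω ∂μ = ∫ s in (0 : ℝ)..1, S.orbit f h s := by
  have hint : ∀ h : Lp ℂ 2 μ, Integrable h μ := fun h => (Lp.memLp h).integrable (by norm_num)
  have hii : ∀ h : Lp ℂ 2 μ, IntervalIntegrable (S.orbit f h) volume 0 1 :=
    fun h => (S.continuous_orbit f (hint h)).intervalIntegrable _ _
  let Λ₀ : Lp ℂ 2 μ →ₗ[ℂ] ℂ :=
    { toFun := fun h => ∫ s in (0 : ℝ)..1, S.orbit f h s
      map_add' := by
        intro h k
        rw [S.orbit_congr f (Lp.coeFn_add h k), ← intervalIntegral.integral_add (hii h) (hii k)]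
        simp only [S.orbit_add f (hint h) (hint k)]
      map_smul' := by
        intro c h
        rw [S.orbit_congr f (Lp.coeFn_smul c h), RingHom.id_apply, smul_eq_mul,
          ← intervalIntegral.integral_const_mul]
        simp only [S.orbit_smul f c] }
  have hΛ₁ : ∀ h : Lp ℂ 2 μ, ‖Λ₀ h‖ ≤ ‖f‖ * ∫ ω, ‖h ω‖ ∂μ := by
    intro h
    have h1 := S.norm_integral_orbit_le f (hint h) 0 1
    rw [sub_zero, abs_one, mul_one] at h1
    exact h1
  -- This only provides continuity on `L_2`, for the Riesz representation; boundedness of `u` comes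
  -- from the `L_1` estimate `hΛ₁`.
  have hL1 : ∀ h : Lp ℂ 2 μ, ∫ ω, ‖h ω‖ ∂μ ≤ ‖h‖ := by
    intro h
    rw [integral_norm_eq_lintegral_enorm (hint h).aestronglyMeasurable, Lp.norm_def,
      ← eLpNorm_one_eq_lintegral_enorm]
    refine ENNReal.toReal_mono (Lp.eLpNorm_ne_top h) ?_
    exact eLpNorm_le_eLpNorm_of_exponent_le (by norm_num) (Lp.aestronglyMeasurable h)
  obtain ⟨u, hu⟩ := exists_linf_of_functional
    (Λ₀.mkContinuous ‖f‖ fun h => (hΛ₁ h).trans (by gcongr; exact hL1 h)) ‖f‖ hΛ₁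
  refine ⟨u, fun h => ?_⟩
  have hm : MemLp h 2 μ := (Lp.memLp h).mono_exponent le_top
  have := hu (hm.toLp h)
  rw [LinearMap.mkContinuous_apply] at this
  change _ = ∫ s in (0 : ℝ)..1, S.orbit f (hm.toLp h) s at this
  rw [S.orbit_congr f hm.coeFn_toLp] at this
  rw [← this]
  refine integral_congr_ae ?_
  filter_upwards [hm.coeFn_toLp] with ω hω
  rw [hω]

/-- An identity with the integral of an orbit extends from bounded to integrable test functions. -/
theorem integral_eq_orbit_of_linf (f v : Lp ℂ ∞ μ) (a b : ℝ)
    (hv : ∀ h : Lp ℂ ∞ μ, ∫ ω, h ω * v ω ∂μ = ∫ s in a..b, S.orbit f h s)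
    {h : Ω → ℂ} (hh : Integrable h μ) :
    ∫ ω, h ω * v ω ∂μ = ∫ s in a..b, S.orbit f h s := by
  have hii : ∀ {h : Ω → ℂ}, Integrable h μ → IntervalIntegrable (S.orbit f h) volume a b :=
    fun hh => (S.continuous_orbit f hh).intervalIntegrable _ _
  have hint : ∀ h : Lp ℂ 1 μ, Integrable h μ := L1.integrable_coeFn
  refine Integrable.induction (fun h => ∫ ω, h ω * v ω ∂μ = ∫ s in a..b, S.orbit f h s)
    ?_ ?_ ?_ ?_ hh
  · intro c s hs _
    have hm : MemLp (s.indicator fun _ => c) ∞ μ := (memLp_const c).indicator hs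
    have := hv (hm.toLp _)
    rw [S.orbit_congr f hm.coeFn_toLp] at this
    rw [← this]
    refine integral_congr_ae ?_
    filter_upwards [hm.coeFn_toLp] with ω hω
    rw [hω]
  · intro h k _ hh hk h1 h2
    simp only [S.orbit_add f hh hk, Pi.add_apply, add_mul]
    rw [intervalIntegral.integral_add (hii hh) (hii hk),
      integral_add (integrable_mul_linf hh _) (integrable_mul_linf hk _), h1, h2]
  · refine isClosed_eq (f := fun h : Lp ℂ 1 μ => ∫ ω, h ω * v ω ∂μ) ?_ ?_
    · refine (LipschitzWith.of_dist_le_mul (K := ‖v‖₊) fun h k => ?_).continuous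
      rw [dist_eq_norm, dist_eq_norm, coe_nnnorm, L1.norm_eq_integral_norm, ← integral_const_mul,
        ← integral_sub (integrable_mul_linf (hint h) _) (integrable_mul_linf (hint k) _)]
      refine norm_integral_le_of_norm_le ((hint (h - k)).norm.const_mul _) ?_
      filter_upwards [ae_norm_le_norm v, Lp.coeFn_sub h k] with ω h1 h2
      rw [h2, Pi.sub_apply, ← sub_mul, norm_mul, mul_comm]
      gcongr
    · refine (LipschitzWith.of_dist_le_mul (K := ‖f‖₊ * ‖b - a‖₊) fun h k => ?_).continuous
      rw [dist_eq_norm, dist_eq_norm, NNReal.coe_mul, coe_nnnorm, coe_nnnorm,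
        L1.norm_eq_integral_norm, ← intervalIntegral.integral_sub (hii (hint h)) (hii (hint k))]
      simp only [← S.orbit_sub f (hint h) (hint k)]
      rw [← S.orbit_congr f (Lp.coeFn_sub h k)]
      refine (S.norm_integral_orbit_le f (hint (h - k)) a b).trans (le_of_eq ?_)
      rw [Real.norm_eq_abs]; ring
  · intro h k hhk _ h1
    rw [← S.orbit_congr f hhk, ← h1]
    refine integral_congr_ae ?_
    filter_upwards [hhk] with ω hω
    rw [hω]

theorem orbit_T (f : Lp ℂ ∞ μ) (h : Lp ℂ ∞ μ) (t : ℝ≥0) {s : ℝ} (hs : 0 ≤ s) :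
    S.orbit f (S.T t h) s = S.orbit f h (s + t) := by
  have h1 : (s + t).toNNReal = t + s.toNNReal := by
    rw [Real.toNNReal_add hs t.coe_nonneg, Real.toNNReal_coe, add_comm]
  rw [orbit, ← S.symmetric_bilin, orbit, h1, S.map_add]
  rfl

/-- Every average lies in the domain of the generator. -/
theorem exists_average_generator (f : Lp ℂ ∞ μ) : ∃ u : Lp ℂ ∞ μ,
    (∀ h : Ω → ℂ, Integrable h μ → ∫ ω, h ω * u ω ∂μ = ∫ s in (0 : ℝ)..1, S.orbit f h s) ∧
    S.IsGenerator u (f - S.T 1 f) ∧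
    ∃ B : ℝ, ∀ t : ℝ≥0, 0 < t → (t : ℝ)⁻¹ * (∫ ω, star (u ω) * (u ω - S.T t u ω) ∂μ).re ≤ B := by
  obtain ⟨u, hu⟩ := S.exists_average f
  have hu' : ∀ h : Ω → ℂ, Integrable h μ →
      ∫ ω, h ω * u ω ∂μ = ∫ s in (0 : ℝ)..1, S.orbit f h s :=
    fun h hh => S.integral_eq_orbit_of_linf f u 0 1 hu hh
  have hTu : ∀ (t : ℝ≥0) (h : Ω → ℂ), Integrable h μ →
      ∫ ω, h ω * S.T t u ω ∂μ = ∫ s in (t : ℝ)..1 + t, S.orbit f h s := by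
    intro t h hh
    refine S.integral_eq_orbit_of_linf f _ _ _ (fun k => ?_) hh
    rw [S.symmetric_bilin, hu]
    have h1 := intervalIntegral.integral_comp_add_right (a := 0) (b := 1) (S.orbit f k) (t : ℝ)
    rw [zero_add] at h1
    rw [← h1]
    refine intervalIntegral.integral_congr fun s hs => ?_
    rw [Set.uIcc_of_le zero_le_one] at hs
    exact S.orbit_T f k t hs.1
  -- `T_t` translates the window `[0, 1]` to `[t, 1 + t]`, and the overlap cancels. Two pieces of
  -- length `t` remain: their derivative at `0` gives `L u = f - T_1 f`, and their length gives a
  -- bound linear in `t`.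
  have hdiff : ∀ (t : ℝ≥0) (h : Ω → ℂ), Integrable h μ →
      ∫ ω, h ω * (u ω - S.T t u ω) ∂μ =
        (∫ s in (0 : ℝ)..t, S.orbit f h s) - ∫ s in (1 : ℝ)..1 + t, S.orbit f h s := by
    intro t h hh
    have hii : ∀ a b, IntervalIntegrable (S.orbit f h) volume a b :=
      fun a b => (S.continuous_orbit f hh).intervalIntegrable a b
    simp only [mul_sub]
    rw [integral_sub (integrable_mul_linf hh _) (integrable_mul_linf hh _), hu' h hh, hTu t h hh,
      ← intervalIntegral.integral_add_adjacent_intervals (hii 0 t) (hii t 1),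
      ← intervalIntegral.integral_add_adjacent_intervals (hii t 1) (hii 1 (1 + t))]
    ring
  refine ⟨u, hu', ?_, ?_⟩
  · intro h
    have hh : Integrable h μ := L1.integrable_coeFn h
    have hc := S.continuous_orbit f hh
    have hd : HasDerivAt (fun t : ℝ =>
        (∫ s in (0 : ℝ)..t, S.orbit f h s) - ∫ s in (1 : ℝ)..1 + t, S.orbit f h s)
        (S.orbit f h 0 - S.orbit f h 1) 0 := by
      refine (hc.integral_hasStrictDerivAt 0 0).hasDerivAt.sub ?_
      have h2 : HasDerivAt (fun x => ∫ s in (1 : ℝ)..x, S.orbit f h s) (S.orbit f h 1) (1 + 0) := by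
        rw [add_zero]; exact (hc.integral_hasStrictDerivAt 1 1).hasDerivAt
      exact h2.comp_const_add 1 0
    have hval : S.orbit f h 0 - S.orbit f h 1 = ∫ ω, h ω * (f - S.T 1 f : Lp ℂ ∞ μ) ω ∂μ := by
      rw [orbit, orbit, Real.toNNReal_zero, Real.toNNReal_one, S.map_zero, LinearMap.id_apply,
        ← integral_sub (integrable_mul_linf hh _) (integrable_mul_linf hh _)]
      refine integral_congr_ae ?_
      filter_upwards [Lp.coeFn_sub f (S.T 1 f)] with ω hω
      rw [hω, Pi.sub_apply, mul_sub]
    rw [← hval]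
    have hs := hd.tendsto_slope_zero_right
    have hlim : Tendsto (fun t : ℝ≥0 => (t : ℝ)) (𝓝[>] 0) (𝓝[>] 0) := by
      refine tendsto_nhdsWithin_iff.2 ⟨?_, ?_⟩
      · exact (NNReal.continuous_coe.tendsto 0).mono_left nhdsWithin_le_nhds
      · filter_upwards [self_mem_nhdsWithin] with t ht
        exact NNReal.coe_pos.2 ht
    refine (hs.comp hlim).congr fun t => ?_
    rw [hdiff t h hh]
    simp
  · refine ⟨‖f‖ * (∫ ω, ‖star (u ω)‖ ∂μ) + ‖f‖ * (∫ ω, ‖star (u ω)‖ ∂μ), fun t ht => ?_⟩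
    have hh : Integrable (fun ω => star (u ω)) μ :=
      (integrable_linf (star u)).congr (Lp.coeFn_star u)
    have ht' : (0 : ℝ) < t := NNReal.coe_pos.2 ht
    rw [inv_mul_le_iff₀ ht']
    refine (Complex.re_le_norm _).trans ?_
    rw [hdiff t _ hh]
    refine (norm_sub_le _ _).trans ?_
    have h1 := S.norm_integral_orbit_le f hh 0 t
    have h2 := S.norm_integral_orbit_le f hh 1 (1 + t)
    rw [sub_zero, abs_of_pos ht'] at h1
    rw [add_sub_cancel_left, abs_of_pos ht'] at h2
    linarith

/-- The domain of the generator contains a nonzero function with mean zero. -/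
theorem exists_mean_zero_mem_dom (hμ : ∃ X : Set Ω, MeasurableSet X ∧ 0 < μ X ∧ μ X < 1) :
    ∃ u g : Lp ℂ ∞ μ, S.IsGenerator u g ∧ ∫ ω, u ω ∂μ = 0 ∧ 0 < ∫ ω, ‖u ω‖ ^ 2 ∂μ ∧
    ∃ B : ℝ, ∀ t : ℝ≥0, 0 < t → (t : ℝ)⁻¹ * (∫ ω, star (u ω) * (u ω - S.T t u ω) ∂μ).re ≤ B := by
  obtain ⟨X, hX, hX0, hX1⟩ := hμ
  have hm : MemLp (X.indicator fun _ => (1 : ℂ)) ∞ μ := (memLp_const 1).indicator hX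
  -- The centered indicator of `X`: its mean is zero, and it does not vanish because `0 < μ X < 1`.
  let f : Lp ℂ ∞ μ := hm.toLp _ - Lp.const ∞ μ (μ.real X : ℂ)
  have hf : ∀ᵐ ω ∂μ, f ω = X.indicator (fun _ => (1 : ℂ)) ω - (μ.real X : ℂ) := by
    filter_upwards [hm.coeFn_toLp, Lp.coeFn_const ∞ μ (μ.real X : ℂ),
      Lp.coeFn_sub (hm.toLp _) (Lp.const ∞ μ (μ.real X : ℂ))] with ω h1 h2 h3
    rw [h3, Pi.sub_apply, h1, h2, Function.const_apply]
  have hmean : ∫ ω, f ω ∂μ = 0 := by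
    rw [integral_congr_ae hf, integral_sub ((integrable_const _).indicator hX) (integrable_const _),
      integral_indicator hX]
    simp
  have hne : 0 < ∫ ω, ‖f ω‖ ^ 2 ∂μ := by
    refine lt_of_le_of_ne (integral_nonneg fun ω => by positivity) fun h0 => ?_
    have h1 := (integral_eq_zero_iff_of_nonneg (fun ω => by positivity) (integrable_norm_sq f)).1
      h0.symm
    have h2 : ∀ᵐ ω ∂μ, ω ∉ X := by
      filter_upwards [h1, hf] with ω h1 h2 h3
      rw [Pi.zero_apply, sq_eq_zero_iff, norm_eq_zero, h2, Set.indicator_of_mem h3] at h1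
      have h4 : μ.real X = 1 := by exact_mod_cast (sub_eq_zero.1 h1).symm
      have h5 : μ X = 1 := by
        rw [← ofReal_measureReal, h4, ENNReal.ofReal_one]
      exact hX1.ne h5
    exact hX0.ne' (measure_eq_zero_iff_ae_notMem.2 h2)
  obtain ⟨u, hu, hgen, hB⟩ := S.exists_average_generator f
  refine ⟨u, _, hgen, ?_, ?_, hB⟩
  · have h1 := hu (fun _ => 1) (integrable_const _)
    simp only [orbit, one_mul, S.integral_T, hmean] at h1
    simpa using h1
  · have hst : Integrable (fun ω => star (f ω)) μ :=
      (integrable_linf (star f)).congr (Lp.coeFn_star f)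
    -- Symmetry splits `T_s` into halves: `⟨f, T_s f⟩ = ‖T_{s/2} f‖² ≥ 0`, positive at `s = 0`.
    -- Hence `⟨f, u⟩ = ∫₀¹ ⟨f, T_s f⟩ ds > 0`, and `u ≠ 0`.
    have hval : ∀ s : ℝ, 0 ≤ s → S.orbit f (fun ω => star (f ω)) s =
        ((∫ ω, ‖S.T (s / 2).toNNReal f ω‖ ^ 2 ∂μ : ℝ) : ℂ) := by
      intro s hs
      have h1 : s.toNNReal = (s / 2).toNNReal + (s / 2).toNNReal := by
        rw [← Real.toNNReal_add (by positivity) (by positivity), add_halves]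
      rw [orbit, h1, S.map_add, LinearMap.comp_apply, S.symmetric, ← integral_complex_ofReal]
      refine integral_congr_ae (ae_of_all _ fun ω => ?_)
      simp only [Complex.star_def]
      rw [← Complex.normSq_eq_conj_mul_self, Complex.normSq_eq_norm_sq]
    have hpos : 0 < ∫ s in (0 : ℝ)..1, (S.orbit f (fun ω => star (f ω)) s).re := by
      refine intervalIntegral.integral_pos zero_lt_one ?_ ?_ ⟨0, by simp, ?_⟩
      · exact (Complex.continuous_re.comp (S.continuous_orbit f hst)).continuousOn
      · intro s hs
        rw [hval s hs.1.le, Complex.ofReal_re]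
        exact integral_nonneg fun ω => by positivity
      · rw [hval 0 le_rfl, Complex.ofReal_re, zero_div, Real.toNNReal_zero, S.map_zero]
        exact hne
    refine lt_of_le_of_ne (integral_nonneg fun ω => by positivity) fun h0 => ?_
    have h1 := (integral_eq_zero_iff_of_nonneg (fun ω => by positivity) (integrable_norm_sq u)).1
      h0.symm
    have h2 := hu _ hst
    have h3 : ∫ ω, star (f ω) * u ω ∂μ = 0 := by
      rw [← integral_zero Ω ℂ (μ := μ)]
      refine integral_congr_ae ?_
      filter_upwards [h1] with ω hω
      rw [Pi.zero_apply, sq_eq_zero_iff, norm_eq_zero] at hω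
      rw [hω, mul_zero]
    have h4 := intervalIntegral.intervalIntegral_re
      ((S.continuous_orbit f hst).intervalIntegrable (μ := volume) 0 1)
    rw [← h2, h3] at h4
    simp only [RCLike.re_to_complex] at h4
    rw [h4] at hpos
    simp at hpos

/-- `T_t u` is nonzero in `L_2` for small times. -/
theorem exists_pos_integral_T_sq_pos (u : Lp ℂ ∞ μ) (hu : 0 < ∫ ω, ‖u ω‖ ^ 2 ∂μ) :
    ∃ t : ℝ≥0, 0 < t ∧ 0 < ∫ ω, ‖S.T t u ω‖ ^ 2 ∂μ := by
  -- Otherwise `⟨u, T_t u⟩ = 0` for all `t > 0`, and weak-* continuity at `0` gives `‖u‖_2 = 0`.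
  by_contra! hcon
  have hst : Integrable (fun ω => star (u ω)) μ :=
    (integrable_linf (star u)).congr (Lp.coeFn_star u)
  have hc := S.continuous_pairing u hst
  have h0 : ∀ t : ℝ≥0, 0 < t → ∫ ω, star (u ω) * S.T t u ω ∂μ = 0 := by
    intro t ht
    have h1 := (integral_eq_zero_iff_of_nonneg (fun ω => by positivity)
      (integrable_norm_sq (S.T t u))).1
      (le_antisymm (hcon t ht) (integral_nonneg fun ω => by positivity))
    rw [← integral_zero Ω ℂ (μ := μ)]
    refine integral_congr_ae ?_
    filter_upwards [h1] with ω hω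
    rw [Pi.zero_apply, sq_eq_zero_iff, norm_eq_zero] at hω
    rw [hω, mul_zero]
  have h1 : Tendsto (fun t : ℝ≥0 => ∫ ω, star (u ω) * S.T t u ω ∂μ) (𝓝[>] 0) (𝓝 0) := by
    refine tendsto_const_nhds.congr' ?_
    filter_upwards [self_mem_nhdsWithin] with t ht
    exact (h0 t ht).symm
  have h2 := tendsto_nhds_unique ((hc.tendsto 0).mono_left nhdsWithin_le_nhds) h1
  rw [S.map_zero] at h2
  have h3 : ∫ ω, star (u ω) * u ω ∂μ = ((∫ ω, ‖u ω‖ ^ 2 ∂μ : ℝ) : ℂ) := by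
    rw [← integral_complex_ofReal]
    refine integral_congr_ae (ae_of_all _ fun ω => ?_)
    simp only [Complex.star_def]
    rw [← Complex.normSq_eq_conj_mul_self, Complex.normSq_eq_norm_sq]
  rw [LinearMap.id_apply, h3] at h2
  exact hu.ne' (by exact_mod_cast h2)

end SymmetricMarkovSemigroup

/-! ### The functional `tr (A ln A)` on 2×2 Hermitian matrices -/

section TwoByTwo

theorem trace_re_eq_eigenvalues {A : Matrix (Fin 2) (Fin 2) ℂ} (hA : A.IsHermitian) :
    A.trace.re = hA.eigenvalues 0 + hA.eigenvalues 1 := by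
  rw [hA.trace_eq_sum_eigenvalues]; simp

theorem det_re_eq_eigenvalues {A : Matrix (Fin 2) (Fin 2) ℂ} (hA : A.IsHermitian) :
    A.det.re = hA.eigenvalues 0 * hA.eigenvalues 1 := by
  rw [hA.det_eq_prod_eigenvalues, Fin.prod_univ_two]
  simp

theorem trLog_eq_sum {A : Matrix (Fin 2) (Fin 2) ℂ} (hA : A.IsHermitian) :
    trLog A = ∑ i, hA.eigenvalues i * Real.log (hA.eigenvalues i) := by
  have h1 : A * cfc Real.log A = Unitary.conjStarAlgAut ℂ _ hA.eigenvectorUnitary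
      (Matrix.diagonal (RCLike.ofReal ∘ hA.eigenvalues) *
        Matrix.diagonal (RCLike.ofReal ∘ Real.log ∘ hA.eigenvalues)) := by
    rw [map_mul, ← hA.spectral_theorem, hA.cfc_eq, Matrix.IsHermitian.cfc]
  rw [trLog, h1, Unitary.conjStarAlgAut_apply, Matrix.trace_mul_comm, ← mul_assoc]
  simp [Matrix.trace]

/-- Sum and product determine a pair up to order. Spectral sums can thus be read off from trace and
determinant, without identifying or ordering eigenvalues. -/
theorem add_eq_of_add_eq_mul_eq (F : ℝ → ℝ) {a b p q : ℝ} (hs : a + b = p + q)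
    (hp : a * b = p * q) : F a + F b = F p + F q := by
  have h : (a - p) * (a - q) = 0 := by linear_combination a * hs - hp
  rcases mul_eq_zero.1 h with h | h
  · have h1 : a = p := by linarith
    have h2 : b = q := by linarith
    rw [h1, h2]
  · have h1 : a = q := by linarith
    have h2 : b = p := by linarith
    rw [h1, h2, add_comm]

theorem trLog_eq_of_trace_det {A : Matrix (Fin 2) (Fin 2) ℂ} (hA : A.IsHermitian) {p q : ℝ}
    (htr : A.trace.re = p + q) (hdet : A.det.re = p * q) :
    trLog A = p * Real.log p + q * Real.log q := by
  rw [trLog_eq_sum hA, Fin.sum_univ_two]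
  exact add_eq_of_add_eq_mul_eq (fun x => x * Real.log x)
    ((trace_re_eq_eigenvalues hA).symm.trans htr) ((det_re_eq_eigenvalues hA).symm.trans hdet)

/-- `tr (A ln A)` in terms of the trace and the determinant of `A`. -/
def entTraceDet (x : ℝ × ℝ) : ℝ :=
  (x.1 + √(x.1 ^ 2 - 4 * x.2)) / 2 * Real.log ((x.1 + √(x.1 ^ 2 - 4 * x.2)) / 2) +
  (x.1 - √(x.1 ^ 2 - 4 * x.2)) / 2 * Real.log ((x.1 - √(x.1 ^ 2 - 4 * x.2)) / 2)

/-- Continuity holds on the whole plane, since `√` is `0` on negative numbers and `x ln x` extends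
continuously by `0`. This yields measurability and boundedness of `tr (G ln G)` without a measurable
choice of eigenvalues. -/
theorem continuous_entTraceDet : Continuous entTraceDet := by
  unfold entTraceDet
  exact (Real.continuous_mul_log.comp (by fun_prop :
      Continuous fun x : ℝ × ℝ => (x.1 + √(x.1 ^ 2 - 4 * x.2)) / 2)).add
    (Real.continuous_mul_log.comp (by fun_prop :
      Continuous fun x : ℝ × ℝ => (x.1 - √(x.1 ^ 2 - 4 * x.2)) / 2))

theorem trLog_eq_entTraceDet {A : Matrix (Fin 2) (Fin 2) ℂ} (hA : A.IsHermitian) :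
    trLog A = entTraceDet (A.trace.re, A.det.re) := by
  refine trLog_eq_of_trace_det hA (by ring) ?_
  have h0 : 0 ≤ A.trace.re ^ 2 - 4 * A.det.re := by
    rw [trace_re_eq_eigenvalues hA, det_re_eq_eigenvalues hA]
    nlinarith [sq_nonneg (hA.eigenvalues 0 - hA.eigenvalues 1)]
  have := Real.sq_sqrt h0
  simp only
  linear_combination this / 4

theorem re_apply_zero_add_one (A : Matrix (Fin 2) (Fin 2) ℂ) :
    A.trace.re = (A 0 0).re + (A 1 1).re := by
  simp [Matrix.trace_fin_two]

theorem det_re_of_isHermitian {A : Matrix (Fin 2) (Fin 2) ℂ} (hA : A.IsHermitian) :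
    A.det.re = (A 0 0).re * (A 1 1).re - ‖A 0 1‖ ^ 2 := by
  have h0 : (A 0 0).im = 0 := by
    have := congrArg Complex.im (hA.apply 0 0); simp at this; linarith
  have h2 : A 1 0 = star (A 0 1) := (hA.apply 1 0).symm
  rw [Matrix.det_fin_two, h2, Complex.star_def, Complex.mul_conj, Complex.normSq_eq_norm_sq]
  simp [h0]
  norm_cast

/-- Peierls' inequality for `x ln x`. -/
theorem diag_le_trLog {A : Matrix (Fin 2) (Fin 2) ℂ} (hA : A.PosSemidef) :
    (A 0 0).re * Real.log (A 0 0).re + (A 1 1).re * Real.log (A 1 1).re ≤ trLog A := by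
  have hH := hA.isHermitian
  rw [trLog_eq_sum hH, Fin.sum_univ_two]
  have htr := (re_apply_zero_add_one A).symm.trans (trace_re_eq_eigenvalues hH)
  have hdet := (det_re_of_isHermitian hH).symm.trans (det_re_eq_eigenvalues hH)
  have ha := hA.eigenvalues_nonneg 0
  have hb := hA.eigenvalues_nonneg 1
  generalize hH.eigenvalues 0 = a at *
  generalize hH.eigenvalues 1 = b at *
  generalize (A 0 0).re = p at *
  generalize (A 1 1).re = q at *
  -- A diagonal entry lies between the eigenvalues, as the product is `-|A₀₁|²`. So `p = θ a + (1 -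
  -- θ) b` and `q = (1 - θ) a + θ b` with `θ = (p - b)/(a - b)`, and convexity is applied to each.
  have hpq : (p - a) * (p - b) ≤ 0 := by
    have : (p - a) * (p - b) = -‖A 0 1‖ ^ 2 := by linear_combination p * htr - hdet
    rw [this]; linarith [sq_nonneg ‖A 0 1‖]
  by_cases hab : a = b
  · subst hab
    have : (p - a) ^ 2 = 0 := le_antisymm (by nlinarith) (sq_nonneg _)
    have hp : p = a := by nlinarith [pow_eq_zero_iff (two_ne_zero) |>.1 this]
    have hq : q = a := by linarith
    rw [hp, hq]
  have hab' : a - b ≠ 0 := sub_ne_zero.2 hab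
  have h2 : 0 < (a - b) ^ 2 := by positivity
  have hθ0 : 0 ≤ (p - b) / (a - b) := by
    rw [← mul_div_mul_right _ _ hab', ← sq]
    refine div_nonneg ?_ h2.le
    nlinarith [sq_nonneg (p - b)]
  have hθ1 : 0 ≤ 1 - (p - b) / (a - b) := by
    rw [one_sub_div hab', ← mul_div_mul_right _ _ hab', ← sq]
    refine div_nonneg ?_ h2.le
    nlinarith [sq_nonneg (p - a)]
  have c1 := Real.convexOn_mul_log.2 ha hb hθ0 hθ1 (by ring)
  have c2 := Real.convexOn_mul_log.2 ha hb hθ1 hθ0 (by ring)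
  simp only [smul_eq_mul] at c1 c2
  have e1 : (p - b) / (a - b) * a + (1 - (p - b) / (a - b)) * b = p := by
    field_simp; ring
  have e2 : (1 - (p - b) / (a - b)) * a + (p - b) / (a - b) * b = q := by
    have : q = a + b - p := by linarith
    rw [this]; field_simp; ring
  rw [e1] at c1
  rw [e2] at c2
  linarith

end TwoByTwo

/-! ### Jensen's inequality and the constant `0` in the entropy inequalities -/

section Entropy

variable {Ω : Type*} [MeasurableSpace Ω] {μ : Measure Ω}

theorem integrable_comp_of_bounded [IsFiniteMeasure μ] {E : Type*} [NormedAddCommGroup E]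
    [ProperSpace E] {Ψ : E → ℝ} (hΨ : Continuous Ψ) {X : Ω → E} (hX : AEStronglyMeasurable X μ)
    {C : ℝ} (hC : ∀ᵐ ω ∂μ, ‖X ω‖ ≤ C) : Integrable (fun ω => Ψ (X ω)) μ := by
  obtain ⟨K, hK⟩ := (isCompact_closedBall (0 : E) C).exists_bound_of_continuousOn hΨ.continuousOn
  refine Integrable.of_bound (hΨ.comp_aestronglyMeasurable hX) K ?_
  filter_upwards [hC] with ω hω
  exact hK _ (mem_closedBall_zero_iff.2 hω)

/-- Essentially bounded measurable matrix-valued functions. -/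
def IsBddFun (μ : Measure Ω) (G : Ω → Matrix (Fin 2) (Fin 2) ℂ) : Prop :=
  ∀ i j, MemLp (fun ω => G ω i j) ∞ μ

theorem IsBddFun.mul {F G : Ω → Matrix (Fin 2) (Fin 2) ℂ} (hF : IsBddFun μ F)
    (hG : IsBddFun μ G) : IsBddFun μ fun ω => F ω * G ω := by
  intro i j
  simp only [Matrix.mul_apply, Fin.sum_univ_two]
  exact ((hG 0 j).mul (hF i 0)).add ((hG 1 j).mul (hF i 1))

theorem IsBddFun.conjTranspose {F : Ω → Matrix (Fin 2) (Fin 2) ℂ} (hF : IsBddFun μ F) :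
    IsBddFun μ fun ω => (F ω)ᴴ := by
  intro i j
  simp only [Matrix.conjTranspose_apply]
  exact (hF j i).star

theorem isBddFun_const [IsFiniteMeasure μ] (A : Matrix (Fin 2) (Fin 2) ℂ) :
    IsBddFun μ fun _ => A := fun i j => memLp_const (A i j)

theorem IsBddFun.sub {F G : Ω → Matrix (Fin 2) (Fin 2) ℂ} (hF : IsBddFun μ F)
    (hG : IsBddFun μ G) : IsBddFun μ fun ω => F ω - G ω :=
  fun i j => (hF i j).sub (hG i j)

theorem isBddFun_toFun (f : MatLinf μ) : IsBddFun μ f.toFun := fun i j => Lp.memLp (f i j)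

theorem MemLp.exists_ae_norm_le {E : Type*} [NormedAddCommGroup E] {X : Ω → E}
    (hX : MemLp X ∞ μ) : ∃ C : ℝ, ∀ᵐ ω ∂μ, ‖X ω‖ ≤ C := by
  refine ⟨(eLpNorm X ∞ μ).toReal, ?_⟩
  filter_upwards [ae_le_eLpNormEssSup (f := X) (μ := μ)] with ω hω
  rw [eLpNorm_exponent_top]
  have h := hX.eLpNorm_ne_top
  rw [eLpNorm_exponent_top] at h
  simpa using ENNReal.toReal_mono h hω

theorem integrable_of_memLp_top [IsFiniteMeasure μ] {E : Type*} [NormedAddCommGroup E] {X : Ω → E}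
    (hX : MemLp X ∞ μ) : Integrable X μ :=
  (hX.mono_exponent le_top : MemLp X 1 μ).integrable le_rfl

theorem IsBddFun.integrable_trLog [IsFiniteMeasure μ] {G : Ω → Matrix (Fin 2) (Fin 2) ℂ}
    (hG : IsBddFun μ G) (hH : ∀ ω, (G ω).IsHermitian) : Integrable (fun ω => trLog (G ω)) μ := by
  have htr : MemLp (fun ω => (G ω).trace.re) ∞ μ := by
    simp only [Matrix.trace_fin_two]
    exact ((hG 0 0).add (hG 1 1)).re
  have hdet : MemLp (fun ω => (G ω).det.re) ∞ μ := by
    simp only [Matrix.det_fin_two]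
    exact (((hG 1 1).mul (hG 0 0)).sub ((hG 1 0).mul (hG 0 1))).re
  obtain ⟨C, hC⟩ := MemLp.exists_ae_norm_le htr
  obtain ⟨D, hD⟩ := MemLp.exists_ae_norm_le hdet
  simp only [trLog_eq_entTraceDet (hH _)]
  refine integrable_comp_of_bounded (X := fun ω => ((G ω).trace.re, (G ω).det.re))
    continuous_entTraceDet (htr.1.prodMk hdet.1) (C := max C D) ?_
  filter_upwards [hC, hD] with ω h1 h2
  exact max_le_max h1 h2

theorem matMean_conj [IsFiniteMeasure μ] {G : Ω → Matrix (Fin 2) (Fin 2) ℂ} (hG : IsBddFun μ G)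
    (A B : Matrix (Fin 2) (Fin 2) ℂ) :
    matMean μ (fun ω => A * G ω * B) = A * matMean μ G * B := by
  have hi : ∀ i j, Integrable (fun ω => G ω i j) μ := fun i j => integrable_of_memLp_top (hG i j)
  ext i j
  simp only [matMean, Matrix.of_apply, Matrix.mul_apply]
  rw [integral_finsetSum _ fun k _ => (integrable_finsetSum _ fun l _ =>
    (hi l k).const_mul _).mul_const _]
  refine Finset.sum_congr rfl fun k _ => ?_
  rw [integral_mul_const, integral_finsetSum _ fun l _ => (hi l k).const_mul _]
  simp only [integral_const_mul]

theorem matMean_isHermitian {G : Ω → Matrix (Fin 2) (Fin 2) ℂ} (hH : ∀ ω, (G ω).IsHermitian) :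
    (matMean μ G).IsHermitian := by
  refine Matrix.IsHermitian.ext fun i j => ?_
  simp only [matMean, Matrix.of_apply, Complex.star_def]
  rw [← integral_conj]
  refine integral_congr_ae (ae_of_all _ fun ω => ?_)
  exact (hH ω).apply i j

/-- Jensen's inequality: the relative entropy with respect to the mean is nonnegative. -/
theorem matEnt_nonneg [IsProbabilityMeasure μ] {G : Ω → Matrix (Fin 2) (Fin 2) ℂ}
    (hG : IsBddFun μ G) (hpos : ∀ ω, (G ω).PosSemidef) : 0 ≤ matEnt μ G := by
  have hM : (matMean μ G).IsHermitian := matMean_isHermitian fun ω => (hpos ω).isHermitian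
  -- In an eigenbasis of the mean, Peierls' inequality bounds `tr (G ln G)` below by its diagonal
  -- version, and scalar Jensen on each diagonal entry finishes.
  let U : Matrix (Fin 2) (Fin 2) ℂ := hM.eigenvectorUnitary
  have hUU : U * Uᴴ = 1 := Unitary.mul_star_self_of_mem hM.eigenvectorUnitary.2
  let G' : Ω → Matrix (Fin 2) (Fin 2) ℂ := fun ω => Uᴴ * G ω * U
  have hG' : IsBddFun μ G' := ((isBddFun_const Uᴴ).mul hG).mul (isBddFun_const U)
  have hpos' : ∀ ω, (G' ω).PosSemidef := fun ω => (hpos ω).conjTranspose_mul_mul_same U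
  have hmean : matMean μ G' = Matrix.diagonal (RCLike.ofReal ∘ hM.eigenvalues) := by
    rw [matMean_conj hG]
    exact (Unitary.conjStarAlgAut_star_apply _ _).symm.trans hM.conjStarAlgAut_star_eigenvectorUnitary
  have hlog : ∀ ω, trLog (G ω) = trLog (G' ω) := by
    intro ω
    rw [trLog_eq_entTraceDet (hpos ω).isHermitian, trLog_eq_entTraceDet (hpos' ω).isHermitian]
    have h1 : (G' ω).trace = (G ω).trace := by
      rw [Matrix.trace_mul_comm, ← mul_assoc, hUU, one_mul]
    have h2 : (G' ω).det = (G ω).det := by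
      rw [Matrix.det_mul_comm, ← mul_assoc, hUU, one_mul]
    rw [h1, h2]
  have hdiag : ∀ i, (∫ ω, (G' ω i i).re ∂μ) = hM.eigenvalues i := by
    intro i
    have h1 := congrArg (fun A => (A i i).re) hmean
    have h2 : (∫ ω, (G' ω i i).re ∂μ) = (∫ ω, G' ω i i ∂μ).re :=
      integral_re (integrable_of_memLp_top (hG' i i))
    rw [h2]
    simpa [matMean] using h1
  have hnn : ∀ i ω, 0 ≤ (G' ω i i).re := fun i ω => (Complex.le_def.1 (hpos' ω).diag_nonneg).1
  have hint : ∀ i, Integrable (fun ω => (G' ω i i).re * Real.log (G' ω i i).re) μ := by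
    intro i
    obtain ⟨C, hC⟩ := MemLp.exists_ae_norm_le (hG' i i).re
    exact integrable_comp_of_bounded Real.continuous_mul_log (hG' i i).re.1 hC
  have hjensen : ∀ i, hM.eigenvalues i * Real.log (hM.eigenvalues i) ≤
      ∫ ω, (G' ω i i).re * Real.log (G' ω i i).re ∂μ := by
    intro i
    rw [← hdiag i]
    exact Real.convexOn_mul_log.map_integral_le Real.continuous_mul_log.continuousOn isClosed_Ici
      (ae_of_all _ fun ω => hnn i ω) (integrable_of_memLp_top (hG' i i)).re (hint i)
  rw [matEnt, sub_nonneg, trLog_eq_sum hM, Fin.sum_univ_two]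
  simp only [hlog]
  calc _ ≤ _ := add_le_add (hjensen 0) (hjensen 1)
    _ = ∫ ω, ((G' ω 0 0).re * Real.log (G' ω 0 0).re + (G' ω 1 1).re * Real.log (G' ω 1 1).re) ∂μ :=
      (integral_add (hint 0) (hint 1)).symm
    _ ≤ _ := integral_mono ((hint 0).add (hint 1))
      (hG'.integrable_trLog fun ω => (hpos' ω).isHermitian) fun ω => diag_le_trLog (hpos' ω)

theorem normSqL2_nonneg (F : Ω → Matrix (Fin 2) (Fin 2) ℂ) : 0 ≤ normSqL2 μ F :=
  integral_nonneg fun ω =>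
    (Complex.le_def.1 (Matrix.posSemidef_conjTranspose_mul_self (F ω)).trace_nonneg).1

namespace SymmetricMarkovSemigroup

variable [IsProbabilityMeasure μ] (S : SymmetricMarkovSemigroup μ)

theorem rothaus_zero (C : Set (MatLinf μ)) : S.Rothaus C 0 := by
  intro f _
  rw [zero_mul]
  refine add_nonneg (matEnt_nonneg ?_ fun ω => Matrix.posSemidef_conjTranspose_mul_self _)
    (normSqL2_nonneg _)
  have h : IsBddFun μ (centered μ f.toFun) := (isBddFun_toFun f).sub (isBddFun_const _)
  exact h.conjTranspose.mul h

theorem logSobolevForm_zero : S.LogSobolevForm 0 := by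
  intro f _
  rw [zero_mul]
  positivity

end SymmetricMarkovSemigroup

end Entropy

/-! ### Entropies of the test function -/

variable {Ω : Type*} [MeasurableSpace Ω] {μ : Measure Ω}

theorem matMean_congr {F G : Ω → Matrix (Fin 2) (Fin 2) ℂ} (h : F =ᵐ[μ] G) :
    matMean μ F = matMean μ G := by
  ext i j
  refine integral_congr_ae ?_
  filter_upwards [h] with ω hω
  rw [hω]

theorem matEnt_congr {F G : Ω → Matrix (Fin 2) (Fin 2) ℂ} (h : F =ᵐ[μ] G) :
    matEnt μ F = matEnt μ G := by
  rw [matEnt, matEnt, matMean_congr h]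
  congr 1
  refine integral_congr_ae ?_
  filter_upwards [h] with ω hω
  rw [hω]

theorem trLog_diag (a b : ℝ) :
    trLog !![(a : ℂ), 0; 0, (b : ℂ)] = a * Real.log a + b * Real.log b := by
  refine trLog_eq_of_trace_det ?_ ?_ ?_
  · refine Matrix.IsHermitian.ext fun i j => ?_
    fin_cases i <;> fin_cases j <;> simp
  · simp [Matrix.trace_fin_two]
  · simp [Matrix.det_fin_two]

theorem integral_sq_smul (u : Lp ℂ ∞ μ) (ε : ℝ) :
    ∫ ω, ((ε ^ 2 * ‖u ω‖ ^ 2 : ℝ) : ℂ) ∂μ = ((ε ^ 2 * ∫ ω, ‖u ω‖ ^ 2 ∂μ : ℝ) : ℂ) := by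
  rw [integral_complex_ofReal, integral_const_mul]

section TestFunction

variable [IsProbabilityMeasure μ]

/-- The function `e₁₁ + ε u e₁₂`. -/
def rowFun (u : Lp ℂ ∞ μ) (ε : ℝ) : MatLinf μ := !![Lp.const ∞ μ 1, (ε : ℂ) • u; 0, 0]

theorem rowFun_toFun (u : Lp ℂ ∞ μ) (ε : ℝ) :
    (rowFun u ε).toFun =ᵐ[μ] fun ω => !![1, ε * u ω; 0, 0] := by
  filter_upwards [Lp.coeFn_smul (ε : ℂ) u] with ω h2
  ext i j
  fin_cases i <;> fin_cases j <;> simp [rowFun, MatLinf.toFun, h2, -Complex.coe_smul]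

theorem sqAbs_rowFun (u : Lp ℂ ∞ μ) (ε : ℝ) : sqAbs (rowFun u ε).toFun =ᵐ[μ] fun ω =>
    !![1, ε * u ω; star (ε * u ω), ((ε ^ 2 * ‖u ω‖ ^ 2 : ℝ) : ℂ)] := by
  filter_upwards [rowFun_toFun u ε] with ω hω
  rw [sqAbs, hω]
  ext i j
  fin_cases i <;> fin_cases j <;> simp [Matrix.mul_apply]
  linear_combination (ε : ℂ) ^ 2 * Complex.conj_mul' (u ω)

theorem matMean_rowFun {u : Lp ℂ ∞ μ} (hu : ∫ ω, u ω ∂μ = 0) (ε : ℝ) :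
    matMean μ (rowFun u ε).toFun = !![1, 0; 0, 0] := by
  rw [matMean_congr (rowFun_toFun u ε)]
  ext i j
  fin_cases i <;> fin_cases j <;> simp [matMean, integral_const_mul, hu]

/-- The logarithmic singularity behind the failure of Rothaus and log-Sobolev: averaging turns a
rank-one matrix with eigenvalue `≥ 1` into one with a small second eigenvalue `ε² s`. -/
theorem neg_mul_log_le_matEnt_rowFun {u : Lp ℂ ∞ μ} (hu : ∫ ω, u ω ∂μ = 0) (ε : ℝ) :
    -((ε ^ 2 * ∫ ω, ‖u ω‖ ^ 2 ∂μ) * Real.log (ε ^ 2 * ∫ ω, ‖u ω‖ ^ 2 ∂μ)) ≤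
      matEnt μ (sqAbs (rowFun u ε).toFun) := by
  rw [matEnt_congr (sqAbs_rowFun u ε), matEnt]
  have h1 : matMean μ (fun ω =>
      !![1, ε * u ω; star (ε * u ω), ((ε ^ 2 * ‖u ω‖ ^ 2 : ℝ) : ℂ)]) =
      !![((1 : ℝ) : ℂ), 0; 0, ((ε ^ 2 * ∫ ω, ‖u ω‖ ^ 2 ∂μ : ℝ) : ℂ)] := by
    rw [← integral_sq_smul]
    have hu' : ∫ ω, (starRingEnd ℂ) (u ω) ∂μ = 0 := by rw [integral_conj, hu, map_zero]
    ext i j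
    fin_cases i <;> fin_cases j <;> simp [matMean, integral_const_mul, hu, hu']
  rw [h1, trLog_diag, Real.log_one, mul_zero, zero_add]
  have h2 : 0 ≤ ∫ ω, trLog !![1, ε * u ω; star (ε * u ω), ((ε ^ 2 * ‖u ω‖ ^ 2 : ℝ) : ℂ)] ∂μ := by
    refine integral_nonneg fun ω => ?_
    have h3 : trLog !![1, ε * u ω; star (ε * u ω), ((ε ^ 2 * ‖u ω‖ ^ 2 : ℝ) : ℂ)] =
        (1 + ε ^ 2 * ‖u ω‖ ^ 2) * Real.log (1 + ε ^ 2 * ‖u ω‖ ^ 2) + 0 * Real.log 0 := by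
      refine trLog_eq_of_trace_det ?_ ?_ ?_
      · refine Matrix.IsHermitian.ext fun i j => ?_
        fin_cases i <;> fin_cases j <;> simp
      · rw [re_apply_zero_add_one]
        simp [-Complex.ofReal_mul, -Complex.ofReal_pow, -Complex.ofReal_add]
      · rw [Matrix.det_fin_two]
        have : ((ε ^ 2 * ‖u ω‖ ^ 2 : ℝ) : ℂ) = ε * u ω * star (ε * u ω) := by
          rw [Complex.star_def, Complex.mul_conj, Complex.normSq_eq_norm_sq, norm_mul, mul_pow]
          simp
        simp [this]
    simp only [Pi.zero_apply]
    rw [h3, zero_mul, add_zero]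
    have h4 : 1 ≤ 1 + ε ^ 2 * ‖u ω‖ ^ 2 := by
      have : 0 ≤ ε ^ 2 * ‖u ω‖ ^ 2 := by positivity
      linarith
    exact mul_nonneg (by linarith) (Real.log_nonneg h4)
  linarith

theorem centered_rowFun {u : Lp ℂ ∞ μ} (hu : ∫ ω, u ω ∂μ = 0) (ε : ℝ) :
    centered μ (rowFun u ε).toFun =ᵐ[μ] fun ω => !![0, ε * u ω; 0, 0] := by
  filter_upwards [rowFun_toFun u ε] with ω hω
  rw [centered, matMean_rowFun hu, hω]
  ext i j
  fin_cases i <;> fin_cases j <;> simp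

theorem sqAbs_centered_rowFun {u : Lp ℂ ∞ μ} (hu : ∫ ω, u ω ∂μ = 0) (ε : ℝ) :
    sqAbs (centered μ (rowFun u ε).toFun) =ᵐ[μ] fun ω =>
      !![((0 : ℝ) : ℂ), 0; 0, ((ε ^ 2 * ‖u ω‖ ^ 2 : ℝ) : ℂ)] := by
  filter_upwards [centered_rowFun hu ε] with ω hω
  rw [sqAbs, hω]
  ext i j
  fin_cases i <;> fin_cases j <;> simp [Matrix.mul_apply]
  linear_combination (ε : ℂ) ^ 2 * Complex.conj_mul' (u ω)

theorem normSqL2_centered_rowFun {u : Lp ℂ ∞ μ} (hu : ∫ ω, u ω ∂μ = 0) (ε : ℝ) :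
    normSqL2 μ (centered μ (rowFun u ε).toFun) = ε ^ 2 * ∫ ω, ‖u ω‖ ^ 2 ∂μ := by
  rw [normSqL2, ← integral_const_mul]
  refine integral_congr_ae ?_
  filter_upwards [sqAbs_centered_rowFun hu ε] with ω hω
  rw [sqAbs] at hω
  rw [hω, re_apply_zero_add_one]
  simp [-Complex.ofReal_mul, -Complex.ofReal_pow]

/-- Without the constant corner only the scalar `ε²|u|²` remains, and its entropy is homogeneous:
the `ln ε²` terms of the two parts cancel after `|u|` is bounded by `‖u‖` inside the logarithm. -/
theorem matEnt_centered_rowFun_le {u : Lp ℂ ∞ μ} (hu : ∫ ω, u ω ∂μ = 0)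
    (hs : 0 < ∫ ω, ‖u ω‖ ^ 2 ∂μ) {ε : ℝ} (hε : 0 < ε) :
    matEnt μ (sqAbs (centered μ (rowFun u ε).toFun)) ≤
      ε ^ 2 * ((∫ ω, ‖u ω‖ ^ 2 ∂μ) * (Real.log (‖u‖ ^ 2) - Real.log (∫ ω, ‖u ω‖ ^ 2 ∂μ))) := by
  rw [matEnt_congr (sqAbs_centered_rowFun hu ε), matEnt]
  have h1 : matMean μ (fun ω => !![((0 : ℝ) : ℂ), 0; 0, ((ε ^ 2 * ‖u ω‖ ^ 2 : ℝ) : ℂ)]) =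
      !![((0 : ℝ) : ℂ), 0; 0, ((ε ^ 2 * ∫ ω, ‖u ω‖ ^ 2 ∂μ : ℝ) : ℂ)] := by
    rw [← integral_sq_smul]
    ext i j
    fin_cases i <;> fin_cases j <;> simp [matMean]
  rw [h1]
  simp only [trLog_diag, zero_mul, zero_add]
  have hu0 : u ≠ 0 := by
    rintro rfl
    refine hs.ne' ?_
    rw [← integral_zero Ω ℝ (μ := μ)]
    refine integral_congr_ae ?_
    refine ae_of_all _ fun ω => ?_
    simp
  have hu1 : 0 < ‖u‖ := norm_pos_iff.2 hu0
  have hle : ∀ᵐ ω ∂μ, ε ^ 2 * ‖u ω‖ ^ 2 ≤ ε ^ 2 * ‖u‖ ^ 2 := by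
    filter_upwards [ae_norm_le_norm u] with ω hω
    gcongr
  have h2 : ∫ ω, ε ^ 2 * ‖u ω‖ ^ 2 * Real.log (ε ^ 2 * ‖u ω‖ ^ 2) ∂μ ≤
      ∫ ω, ε ^ 2 * ‖u ω‖ ^ 2 * Real.log (ε ^ 2 * ‖u‖ ^ 2) ∂μ := by
    refine integral_mono_ae ?_ (((integrable_norm_sq u).const_mul _).mul_const _) ?_
    · refine integrable_comp_of_bounded (X := fun ω => ε ^ 2 * ‖u ω‖ ^ 2) Real.continuous_mul_log
        (((aesm u).norm.pow 2).const_mul _) (C := ε ^ 2 * ‖u‖ ^ 2) ?_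
      filter_upwards [hle] with ω hω
      rwa [Real.norm_of_nonneg (by positivity)]
    · filter_upwards [hle] with ω hω
      rcases (by positivity : 0 ≤ ε ^ 2 * ‖u ω‖ ^ 2).eq_or_lt with h | h
      · simp [← h]
      · exact mul_le_mul_of_nonneg_left (Real.log_le_log h hω) h.le
  rw [integral_mul_const, integral_const_mul] at h2
  have hε2 : ε ^ 2 ≠ 0 := by positivity
  rw [Real.log_mul hε2 (by positivity)] at h2
  rw [Real.log_mul hε2 hs.ne']
  linarith

theorem nonpos_of_forall_mul_neg_mul_log_le {α s K : ℝ} (hs : 0 < s)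
    (h : ∀ ε : ℝ, 0 < ε → 0 ≤ α → α * -((ε ^ 2 * s) * Real.log (ε ^ 2 * s)) ≤ ε ^ 2 * K) :
    α ≤ 0 := by
  by_contra! hα
  -- With `ε² s = e^{-M}` the hypothesis becomes `α s M ≤ K`, while this `M` gives `α s M = K + 1`.
  let M : ℝ := (K + 1) / (α * s)
  have h1 : √(Real.exp (-M) / s) ^ 2 = Real.exp (-M) / s := Real.sq_sqrt (by positivity)
  have h2 := h (√(Real.exp (-M) / s)) (by positivity) hα.le
  rw [h1, div_mul_cancel₀ _ hs.ne', Real.log_exp] at h2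
  have hM : M * (α * s) = K + 1 := div_mul_cancel₀ _ (by positivity)
  have h3 : α * -(Real.exp (-M) * -M) = Real.exp (-M) / s * (K + 1) := by
    rw [← hM]; field_simp
  rw [h3] at h2
  have := le_of_mul_le_mul_left h2 (by positivity)
  linarith

end TestFunction

/-! ### Upper bounds for the Rothaus and log-Sobolev constants -/

namespace SymmetricMarkovSemigroup

variable [IsProbabilityMeasure μ] (S : SymmetricMarkovSemigroup μ)

theorem amp_rowFun (t : ℝ≥0) (u : Lp ℂ ∞ μ) (ε : ℝ) :
    S.amp t (rowFun u ε) = rowFun (S.T t u) ε := by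
  ext1 i j
  fin_cases i <;> fin_cases j <;> simp [amp, rowFun, S.T_const, -Complex.coe_smul]

theorem isGenerator_of_fixed {f : Lp ℂ ∞ μ} (hf : ∀ t, S.T t f = f) : S.IsGenerator f 0 := by
  intro h
  have h1 : ∫ ω, h ω * (0 : Lp ℂ ∞ μ) ω ∂μ = 0 := by
    rw [← integral_zero Ω ℂ (μ := μ)]
    refine integral_congr_ae ?_
    filter_upwards [Lp.coeFn_zero ℂ ∞ μ] with ω hω
    rw [hω]; simp
  rw [h1]
  simp [hf]

theorem IsGenerator.smul {S : SymmetricMarkovSemigroup μ} {f g : Lp ℂ ∞ μ}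
    (h : S.IsGenerator f g) (c : ℂ) : S.IsGenerator (c • f) (c • g) := by
  intro k
  have h1 : ∫ ω, k ω * (c • g) ω ∂μ = c * ∫ ω, k ω * g ω ∂μ := by
    rw [← integral_const_mul]
    refine integral_congr_ae ?_
    filter_upwards [Lp.coeFn_smul c g] with ω hω
    rw [hω, Pi.smul_apply, smul_eq_mul]; ring
  rw [h1]
  refine ((h k).const_mul c).congr fun t => ?_
  have h2 : ∫ ω, k ω * ((c • f) ω - S.T t (c • f) ω) ∂μ =
      c * ∫ ω, k ω * (f ω - S.T t f ω) ∂μ := by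
    rw [← integral_const_mul]
    refine integral_congr_ae ?_
    rw [map_smul]
    filter_upwards [Lp.coeFn_smul c f, Lp.coeFn_smul c (S.T t f)] with ω h1 h2
    rw [h1, h2, Pi.smul_apply, Pi.smul_apply, smul_eq_mul, smul_eq_mul]; ring
  rw [h2]; ring

theorem isMatGenerator_rowFun {u g : Lp ℂ ∞ μ} (h : S.IsGenerator u g) (ε : ℝ) :
    S.IsMatGenerator (rowFun u ε) !![0, (ε : ℂ) • g; 0, 0] := by
  have h0 : S.IsGenerator 0 0 := S.isGenerator_of_fixed fun t => _root_.map_zero _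
  have h1 : S.IsGenerator (Lp.const ∞ μ 1) 0 := S.isGenerator_of_fixed fun t => S.T_const t 1
  intro i j
  fin_cases i <;> fin_cases j
  · exact h1
  · exact h.smul _
  · exact h0
  · exact h0

theorem energy_rowFun_le {u : Lp ℂ ∞ μ} {B : ℝ} (hB : ∀ t : ℝ≥0, 0 < t →
    (t : ℝ)⁻¹ * (∫ ω, star (u ω) * (u ω - S.T t u ω) ∂μ).re ≤ B) (ε : ℝ) :
    S.energy (rowFun u ε) ≤ ENNReal.ofReal (ε ^ 2 * B) := by
  refine iSup₂_le fun t ht => ENNReal.ofReal_le_ofReal ?_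
  have h1 : ∫ ω, (((rowFun u ε).toFun ω)ᴴ *
      ((rowFun u ε).toFun ω - (S.amp t (rowFun u ε)).toFun ω)).trace ∂μ =
      ((ε ^ 2 : ℝ) : ℂ) * ∫ ω, star (u ω) * (u ω - S.T t u ω) ∂μ := by
    rw [← integral_const_mul, S.amp_rowFun]
    refine integral_congr_ae ?_
    filter_upwards [rowFun_toFun u ε, rowFun_toFun (S.T t u) ε] with ω h1 h2
    rw [h1, h2]
    simp [Matrix.trace_fin_two, Matrix.mul_apply]
    ring
  rw [h1, Complex.re_ofReal_mul]
  calc _ = ε ^ 2 * ((t : ℝ)⁻¹ * (∫ ω, star (u ω) * (u ω - S.T t u ω) ∂μ).re) := by ring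
    _ ≤ _ := mul_le_mul_of_nonneg_left (hB t ht) (sq_nonneg ε)

theorem integral_trace_rowFun (u g : Lp ℂ ∞ μ) (ε : ℝ) :
    (∫ ω, (((rowFun u ε).toFun ω)ᴴ *
      MatLinf.toFun (μ := μ) !![0, (ε : ℂ) • g; 0, 0] ω).trace ∂μ).re =
      ε ^ 2 * (∫ ω, star (u ω) * g ω ∂μ).re := by
  rw [← Complex.re_ofReal_mul, ← integral_const_mul]
  congr 1
  refine integral_congr_ae ?_
  filter_upwards [rowFun_toFun u ε, Lp.coeFn_smul (ε : ℂ) g] with ω h1 h2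
  rw [h1]
  simp [Matrix.trace_fin_two, Matrix.mul_apply, MatLinf.toFun, h2, -Complex.coe_smul]
  ring

theorem rothaus_nonpos {C : Set (MatLinf μ)} {u : Lp ℂ ∞ μ} (hu : ∫ ω, u ω ∂μ = 0)
    (hs : 0 < ∫ ω, ‖u ω‖ ^ 2 ∂μ) (hC : ∀ ε, rowFun u ε ∈ C) {α : ℝ} (h : S.Rothaus C α) :
    α ≤ 0 := by
  refine nonpos_of_forall_mul_neg_mul_log_le (K := (∫ ω, ‖u ω‖ ^ 2 ∂μ) *
    (Real.log (‖u‖ ^ 2) - Real.log (∫ ω, ‖u ω‖ ^ 2 ∂μ)) + ∫ ω, ‖u ω‖ ^ 2 ∂μ) hs fun ε hε hα => ?_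
  have h1 := h _ (hC ε)
  rw [normSqL2_centered_rowFun hu] at h1
  have h2 := mul_le_mul_of_nonneg_left (neg_mul_log_le_matEnt_rowFun hu ε) hα
  have h3 := matEnt_centered_rowFun_le hu hs hε
  linarith

theorem logSobolevForm_nonpos {u : Lp ℂ ∞ μ} (hu : ∫ ω, u ω ∂μ = 0)
    (hs : 0 < ∫ ω, ‖u ω‖ ^ 2 ∂μ) {B : ℝ} (hB : ∀ t : ℝ≥0, 0 < t →
    (t : ℝ)⁻¹ * (∫ ω, star (u ω) * (u ω - S.T t u ω) ∂μ).re ≤ B) {α : ℝ}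
    (h : S.LogSobolevForm α) : α ≤ 0 := by
  refine nonpos_of_forall_mul_neg_mul_log_le (K := 2 * max B 0) hs fun ε hε hα => ?_
  have h0 := S.energy_rowFun_le hB ε
  have h1 := h (rowFun u ε) (h0.trans_lt ENNReal.ofReal_lt_top)
  have h2 := mul_le_mul_of_nonneg_left (neg_mul_log_le_matEnt_rowFun hu ε) hα
  have h3 : (S.energy (rowFun u ε)).toReal ≤ ε ^ 2 * max B 0 := by
    refine ENNReal.toReal_le_of_le_ofReal (by positivity) (h0.trans (ENNReal.ofReal_le_ofReal ?_))
    gcongr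
    exact le_max_left _ _
  linarith

theorem logSobolevGen_nonpos {u g : Lp ℂ ∞ μ} (hu : ∫ ω, u ω ∂μ = 0)
    (hs : 0 < ∫ ω, ‖u ω‖ ^ 2 ∂μ) (hg : S.IsGenerator u g) {α : ℝ}
    (h : S.LogSobolevGen α) : α ≤ 0 := by
  refine nonpos_of_forall_mul_neg_mul_log_le (K := (∫ ω, star (u ω) * g ω ∂μ).re) hs
    fun ε hε hα => ?_
  have h1 := h _ _ (S.isMatGenerator_rowFun hg ε)
  rw [integral_trace_rowFun] at h1
  exact (mul_le_mul_of_nonneg_left (neg_mul_log_le_matEnt_rowFun hu ε) hα).trans h1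

/-- The arithmetic–geometric mean inequality and contractivity on `L_2`. It makes `f - T_t f` pair
nonnegatively with `f`, hence also `L f`. -/
theorem re_integral_star_mul_T_le (t : ℝ≥0) (f : Lp ℂ ∞ μ) :
    (∫ ω, star (f ω) * S.T t f ω ∂μ).re ≤ ∫ ω, ‖f ω‖ ^ 2 ∂μ := by
  have h1 : (∫ ω, star (f ω) * S.T t f ω ∂μ).re = ∫ ω, (star (f ω) * S.T t f ω).re ∂μ :=
    (integral_re (integrable_star_mul f (S.T t f))).symm
  have h2 : ∫ ω, (star (f ω) * S.T t f ω).re ∂μ ≤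
      ∫ ω, (‖f ω‖ ^ 2 + ‖S.T t f ω‖ ^ 2) / 2 ∂μ := by
    refine integral_mono (integrable_star_mul f (S.T t f)).re
      (((integrable_norm_sq f).add (integrable_norm_sq (S.T t f))).div_const 2) fun ω => ?_
    refine (Complex.re_le_norm _).trans ?_
    rw [norm_mul, norm_star]
    nlinarith [sq_nonneg (‖f ω‖ - ‖S.T t f ω‖)]
  rw [integral_div, integral_add (integrable_norm_sq f) (integrable_norm_sq _)] at h2
  linarith [S.integral_T_sq_le t f]

theorem IsGenerator.re_integral_nonneg {S : SymmetricMarkovSemigroup μ} {f g : Lp ℂ ∞ μ}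
    (h : S.IsGenerator f g) : 0 ≤ (∫ ω, star (f ω) * g ω ∂μ).re := by
  have hst : Integrable (fun ω => star (f ω)) μ :=
    (integrable_linf (star f)).congr (Lp.coeFn_star f)
  have hcongr : ∀ k : Ω → ℂ, ∫ ω, hst.toL1 _ ω * k ω ∂μ = ∫ ω, star (f ω) * k ω ∂μ := by
    intro k
    refine integral_congr_ae ?_
    filter_upwards [hst.coeFn_toL1] with ω hω
    rw [hω]
  have h1 := h hst.toL1
  rw [hcongr] at h1
  refine ge_of_tendsto ((Complex.continuous_re.tendsto _).comp h1) (Eventually.of_forall fun t => ?_)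
  simp only [Function.comp_apply]
  rw [hcongr fun ω => f ω - S.T t f ω, ← Complex.ofReal_inv, Complex.re_ofReal_mul]
  refine mul_nonneg (by positivity) ?_
  have h2 := S.re_integral_star_mul_T_le t f
  have h3 : ∫ ω, star (f ω) * f ω ∂μ = ((∫ ω, ‖f ω‖ ^ 2 ∂μ : ℝ) : ℂ) := by
    rw [← integral_complex_ofReal]
    refine integral_congr_ae (ae_of_all _ fun ω => ?_)
    simp only [Complex.star_def]
    rw [← Complex.normSq_eq_conj_mul_self, Complex.normSq_eq_norm_sq]
  simp only [mul_sub]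
  rw [integral_sub (integrable_star_mul f f) (integrable_star_mul f _), h3, Complex.sub_re,
    Complex.ofReal_re]
  linarith

theorem logSobolevGen_zero : S.LogSobolevGen 0 := by
  intro f g h
  rw [zero_mul]
  have hi : ∀ i j, Integrable (fun ω => star (f i j ω) * g i j ω) μ :=
    fun i j => integrable_star_mul _ _
  have h1 : ∫ ω, ((f.toFun ω)ᴴ * g.toFun ω).trace ∂μ =
      ∑ j, ∑ i, ∫ ω, star (f i j ω) * g i j ω ∂μ := by
    simp only [Matrix.trace, Matrix.diag, Matrix.mul_apply, Matrix.conjTranspose_apply,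
      MatLinf.toFun, Matrix.of_apply]
    rw [integral_finsetSum _ fun j _ => integrable_finsetSum _ fun i _ => hi i j]
    exact Finset.sum_congr rfl fun j _ => integral_finsetSum _ fun i _ => hi i j
  rw [h1, Complex.re_sum]
  refine Finset.sum_nonneg fun j _ => ?_
  rw [Complex.re_sum]
  exact Finset.sum_nonneg fun i _ => (h i j).re_integral_nonneg

end SymmetricMarkovSemigroup

/-! ### Schatten norms on 2×2 matrices and the spectral gap estimate -/

section Schatten

theorem schattenNorm_two (A : Matrix (Fin 2) (Fin 2) ℂ) :
    schattenNorm 2 A = √(Aᴴ * A).trace.re := by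
  have hA := Matrix.isHermitian_conjTranspose_mul_self A
  have hnn := (Matrix.posSemidef_conjTranspose_mul_self A).eigenvalues_nonneg
  rw [schattenNorm, EuclideanSpace.norm_eq, trace_re_eq_eigenvalues hA, Fin.sum_univ_two]
  simp only [Real.norm_eq_abs, sq_abs]
  rw [Real.sq_sqrt (hnn 0), Real.sq_sqrt (hnn 1)]

theorem schattenNorm_top_one : schattenNorm ∞ 1 = 1 := by
  have h : ∀ i, (Matrix.isHermitian_conjTranspose_mul_self
      (1 : Matrix (Fin 2) (Fin 2) ℂ)).eigenvalues i = 1 := by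
    have hA := Matrix.isHermitian_conjTranspose_mul_self (1 : Matrix (Fin 2) (Fin 2) ℂ)
    have h1 : 2 = hA.eigenvalues 0 + hA.eigenvalues 1 :=
      (by simp : (2 : ℝ) = _).trans (trace_re_eq_eigenvalues hA)
    have h2 : 1 = hA.eigenvalues 0 * hA.eigenvalues 1 :=
      (by simp : (1 : ℝ) = _).trans (det_re_eq_eigenvalues hA)
    have h3 : (hA.eigenvalues 0 - 1) ^ 2 = 0 := by
      have : hA.eigenvalues 1 = 2 - hA.eigenvalues 0 := by linarith
      rw [this] at h2; linarith
    have h4 : hA.eigenvalues 0 = 1 := by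
      linarith [pow_eq_zero_iff (two_ne_zero) |>.1 h3]
    intro i
    fin_cases i
    · exact h4
    · show hA.eigenvalues 1 = 1
      linarith
  have h' : (fun i : Fin 2 => √((Matrix.isHermitian_conjTranspose_mul_self
      (1 : Matrix (Fin 2) (Fin 2) ℂ)).eigenvalues i)) = fun _ => 1 :=
    funext fun i => by rw [h i, Real.sqrt_one]
  rw [schattenNorm, h', PiLp.norm_eq_ciSup]
  simp

/-- A singular 2×2 matrix has at most one nonzero singular value, so its Hilbert–Schmidt norm is
that value. -/
theorem sqrt_trace_le_schattenNorm {p : ℝ≥0∞} (hp : 1 ≤ p) {A : Matrix (Fin 2) (Fin 2) ℂ}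
    (hA : A.det = 0) : √(Aᴴ * A).trace.re ≤ schattenNorm p A := by
  have : Fact (1 ≤ p) := ⟨hp⟩
  have hH := Matrix.isHermitian_conjTranspose_mul_self A
  have h1 := det_re_eq_eigenvalues hH
  rw [Matrix.det_mul, hA, mul_zero, Complex.zero_re] at h1
  have h2 : ∀ i, √(hH.eigenvalues i) ≤ schattenNorm p A := fun i =>
    (le_abs_self _).trans (PiLp.norm_apply_le (WithLp.toLp p fun i : Fin 2 => √(hH.eigenvalues i)) i)
  rw [trace_re_eq_eigenvalues hH]
  rcases mul_eq_zero.1 h1.symm with h | h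
  · rw [h, zero_add]; exact h2 1
  · rw [h, add_zero]; exact h2 0

theorem sum_eigenvalues_rpow_of_schattenNorm_eq_one {p : ℝ≥0∞} (hp : 0 < p.toReal)
    {A : Matrix (Fin 2) (Fin 2) ℂ} (hA : schattenNorm p A = 1) :
    ((Matrix.isHermitian_conjTranspose_mul_self A).eigenvalues 0) ^ (p.toReal / 2) +
      ((Matrix.isHermitian_conjTranspose_mul_self A).eigenvalues 1) ^ (p.toReal / 2) = 1 := by
  have hnn := (Matrix.posSemidef_conjTranspose_mul_self A).eigenvalues_nonneg
  rw [schattenNorm, PiLp.norm_eq_sum hp, Fin.sum_univ_two] at hA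
  have h1 : ∀ i, ‖√((Matrix.isHermitian_conjTranspose_mul_self A).eigenvalues i)‖ ^ p.toReal =
      ((Matrix.isHermitian_conjTranspose_mul_self A).eigenvalues i) ^ (p.toReal / 2) := by
    intro i
    rw [Real.norm_of_nonneg (Real.sqrt_nonneg _), Real.sqrt_eq_rpow, ← Real.rpow_mul (hnn i)]
    congr 1; ring
  simp only [h1] at hA
  have h0 : 0 ≤ ((Matrix.isHermitian_conjTranspose_mul_self A).eigenvalues 0) ^ (p.toReal / 2) +
      ((Matrix.isHermitian_conjTranspose_mul_self A).eigenvalues 1) ^ (p.toReal / 2) :=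
    add_nonneg (Real.rpow_nonneg (hnn 0) _) (Real.rpow_nonneg (hnn 1) _)
  have h2 := congrArg (· ^ p.toReal) hA
  rwa [← Real.rpow_mul h0, one_div_mul_cancel hp.ne', Real.rpow_one, Real.one_rpow] at h2

/-- The diagonal entries of the inverse of `A* A`, for `A` of unit Schatten norm. -/
theorem exists_inv_diag {p : ℝ≥0∞} (hp : 0 < p.toReal) {A : Matrix (Fin 2) (Fin 2) ℂ}
    (hA : A.PosDef) (hn : schattenNorm p A = 1) : ∃ a b d e : ℝ,
      0 ≤ a ∧ 0 ≤ b ∧ 0 < d ∧ 0 < e ∧ a + b = d + e ∧ d * e ≤ a * b ∧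
      d ^ (p.toReal / 2) + e ^ (p.toReal / 2) = 1 ∧
      (Aᴴ * A)⁻¹ 0 0 = ((b / (d * e) : ℝ) : ℂ) ∧ (Aᴴ * A)⁻¹ 1 1 = ((a / (d * e) : ℝ) : ℂ) := by
  have hH := Matrix.isHermitian_conjTranspose_mul_self A
  have hpos : (Aᴴ * A).PosDef :=
    Matrix.PosDef.conjTranspose_mul_self A (Matrix.mulVec_injective_of_isUnit hA.isUnit)
  have hdiag : ∀ i, (Aᴴ * A) i i = (((Aᴴ * A) i i).re : ℂ) := fun i =>
    Complex.ext rfl (by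
      have := congrArg Complex.im (hH.apply i i)
      rw [Complex.star_def, Complex.conj_im] at this
      rw [Complex.ofReal_im]; linarith)
  have hnn : ∀ i, 0 ≤ ((Aᴴ * A) i i).re := fun i =>
    (Complex.le_def.1 hpos.posSemidef.diag_nonneg).1
  have hdet : (Aᴴ * A).det = ((hH.eigenvalues 0 * hH.eigenvalues 1 : ℝ) : ℂ) := by
    rw [hH.det_eq_prod_eigenvalues, Fin.prod_univ_two]; simp
  -- `a`, `b` are the diagonal entries and `d`, `e` the eigenvalues of `A* A`. Then `d e ≤ a b` is
  -- Hadamard's inequality, and the adjugate formula gives the inverse.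
  refine ⟨((Aᴴ * A) 0 0).re, ((Aᴴ * A) 1 1).re, hH.eigenvalues 0, hH.eigenvalues 1,
    hnn 0, hnn 1, hpos.eigenvalues_pos 0, hpos.eigenvalues_pos 1, ?_, ?_,
    sum_eigenvalues_rpow_of_schattenNorm_eq_one hp hn, ?_, ?_⟩
  · rw [← re_apply_zero_add_one, trace_re_eq_eigenvalues hH]
  · have := (det_re_of_isHermitian hH).symm.trans (det_re_eq_eigenvalues hH)
    nlinarith [sq_nonneg ‖(Aᴴ * A) 0 1‖]
  · rw [Matrix.inv_def, hdet, Ring.inverse_eq_inv', Matrix.adjugate_fin_two, Matrix.smul_apply]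
    simp only [Matrix.of_apply, Matrix.cons_val_zero, Matrix.cons_val', smul_eq_mul]
    rw [hdiag 1, ← Complex.ofReal_inv, ← Complex.ofReal_mul, Complex.ofReal_re, div_eq_inv_mul]
  · rw [Matrix.inv_def, hdet, Ring.inverse_eq_inv', Matrix.adjugate_fin_two, Matrix.smul_apply]
    simp only [Matrix.of_apply, Matrix.cons_val_one, Matrix.cons_val', smul_eq_mul,
      Matrix.cons_val_fin_one]
    rw [hdiag 0, ← Complex.ofReal_inv, ← Complex.ofReal_mul, Complex.ofReal_re, div_eq_inv_mul]

/-- Unit `R`-norm forces `d, e ≤ 1`. The relation `(a - d)(a - e) = d e - a b ≤ 0` places `a`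
between them, and a diagonal entry of the inverse is at least the reciprocal of that entry. -/
theorem one_le_diag_inv {R a b d e : ℝ} (hR : 1 ≤ R) (ha : 0 ≤ a) (hd : 0 < d)
    (he : 0 < e) (hs : a + b = d + e) (hp : d * e ≤ a * b) (h1 : d ^ R + e ^ R = 1) :
    1 ≤ b / (d * e) ∧ a ≤ 1 ∧ 1 / a ≤ b / (d * e) := by
  have hR0 : 0 < R := by linarith
  have hd1 : d ≤ 1 := by
    by_contra! h
    have := Real.one_lt_rpow h hR0
    linarith [Real.rpow_pos_of_pos he R]
  have he1 : e ≤ 1 := by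
    by_contra! h
    have := Real.one_lt_rpow h hR0
    linarith [Real.rpow_pos_of_pos hd R]
  have ha1 : a ≤ 1 := by
    by_contra! h
    have hb : b = d + e - a := by linarith
    rw [hb] at hp
    nlinarith [mul_pos (show 0 < a - d by linarith) (show 0 < a - e by linarith)]
  have ha0 : 0 < a := by
    refine lt_of_le_of_ne ha fun h => ?_
    rw [← h, zero_mul] at hp
    linarith [mul_pos hd he]
  have h2 : 1 / a ≤ b / (d * e) := by
    rw [div_le_div_iff₀ ha0 (mul_pos hd he)]; linarith
  refine ⟨le_trans ?_ h2, ha1, h2⟩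
  rw [le_div_iff₀ ha0]; linarith

/-- A uniform lower bound for `tr (ρ W)` with `ρ = diag(1, s)` and `W⁻¹` of unit Schatten norm. -/
theorem exists_gap {R K : ℝ} (hR : 1 ≤ R) (hK : 0 < K) : ∃ η : ℝ, 0 < η ∧
    ∀ a b d e s : ℝ, 0 ≤ a → 0 ≤ b → 0 < d → 0 < e → 0 ≤ s → a + b = d + e → d * e ≤ a * b →
      d ^ R + e ^ R = 1 → 1 + min (K * s) η ≤ b / (d * e) + s * (a / (d * e)) := by
  have hR0 : 0 < R := by linarith
  refine ⟨min (1 / (2 * K)) ((1 / (2 * K)) ^ R / R), by positivity, ?_⟩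
  suffices h : ∀ a b d e s : ℝ, 0 ≤ a → 0 ≤ b → 0 < d → 0 < e → 0 ≤ s → a + b = d + e →
      d * e ≤ a * b → d ^ R + e ^ R = 1 → e ≤ d →
      1 + min (K * s) (min (1 / (2 * K)) ((1 / (2 * K)) ^ R / R)) ≤
        b / (d * e) + s * (a / (d * e)) by
    intro a b d e s ha hb hd he hs hsum hprod h1
    rcases le_total e d with hed | hed
    · exact h a b d e s ha hb hd he hs hsum hprod h1 hed
    · have := h a b e d s ha hb he hd hs (by linarith) (by linarith) (by linarith) hed
      rwa [mul_comm e d] at this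
  intro a b d e s ha hb hd he hs hsum hprod h1 hed
  have hde := mul_pos hd he
  obtain ⟨hA1, ha1, hA2⟩ := one_le_diag_inv hR ha hd he hsum hprod h1
  obtain ⟨hB1, hb1, hB2⟩ := one_le_diag_inv (b := a) hR hb hd he (by linarith) (by linarith) h1
  have hsB : 0 ≤ s * (a / (d * e)) := by positivity
  -- A small `b` makes the second diagonal entry `a/(d e) ≥ 1/b` at least `K`, giving the term `K
  -- s`. Otherwise `b > 1/K`, and the unit norm keeps `a` below `1` by at least `η`.
  by_cases hbK : b ≤ 1 / K
  · have hb0 : 0 < b := by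
      refine lt_of_le_of_ne hb fun h => ?_
      rw [← h, mul_zero] at hprod
      linarith
    have h2 : K ≤ a / (d * e) := by
      refine le_trans ?_ hB2
      rw [le_div_iff₀ hb0]
      calc K * b ≤ K * (1 / K) := by gcongr
        _ = 1 := by field_simp
    have h3 : K * s ≤ s * (a / (d * e)) := by
      rw [mul_comm]; gcongr
    linarith [min_le_left (K * s) (min (1 / (2 * K)) ((1 / (2 * K)) ^ R / R))]
  push Not at hbK
  have ha0 : 0 < a := by
    refine lt_of_le_of_ne ha fun h => ?_
    rw [← h, zero_mul] at hprod
    linarith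
  have hinv : 1 + (1 - a) ≤ b / (d * e) := by
    refine le_trans ?_ hA2
    rw [le_div_iff₀ ha0]
    nlinarith [sq_nonneg (1 - a)]
  -- If `1 - a < 1/(2K)`, then `e = a + b - d > 1/(2K)` because `d ≤ 1`. Bernoulli's inequality `1 +
  -- R(d - 1) ≤ d^R = 1 - e^R` gives `1 - d ≥ e^R / R`, and `a ≤ d`.
  have hη : min (1 / (2 * K)) ((1 / (2 * K)) ^ R / R) ≤ 1 - a := by
    by_cases hδ : 1 / (2 * K) ≤ 1 - a
    · exact (min_le_left _ _).trans hδ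
    push Not at hδ
    refine (min_le_right _ _).trans ?_
    have hd1 : d ≤ 1 := by
      by_contra! h
      have := Real.one_lt_rpow h hR0
      linarith [Real.rpow_pos_of_pos he R]
    have had : a ≤ d := by
      by_contra! h
      have hb' : b = d + e - a := by linarith
      rw [hb'] at hprod
      nlinarith [mul_pos (show 0 < a - d by linarith) (show 0 < a - e by linarith)]
    have he2 : 1 / (2 * K) ≤ e := by
      have : 1 / K = 2 * (1 / (2 * K)) := by field_simp
      linarith
    have h3 : (1 / (2 * K)) ^ R ≤ e ^ R := Real.rpow_le_rpow (by positivity) he2 hR0.le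
    have h4 := one_add_mul_self_le_rpow_one_add (s := d - 1) (by linarith) hR
    rw [add_sub_cancel] at h4
    rw [div_le_iff₀ hR0]
    nlinarith
  linarith [min_le_right (K * s) (min (1 / (2 * K)) ((1 / (2 * K)) ^ R / R))]

end Schatten

/-! ### Pisier norms and hypercontractivity -/

section Norms

variable {Ω : Type*} [MeasurableSpace Ω] {μ : Measure Ω}

theorem memLp_sqrt_top {g : Ω → ℝ} (hg : MemLp g ∞ μ) : MemLp (fun ω => √(g ω)) ∞ μ := by
  obtain ⟨C, hC⟩ := MemLp.exists_ae_norm_le hg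
  refine memLp_top_of_bound (Real.continuous_sqrt.comp_aestronglyMeasurable hg.1) (√C) ?_
  filter_upwards [hC] with ω hω
  rw [Real.norm_of_nonneg (Real.sqrt_nonneg _)]
  exact Real.sqrt_le_sqrt ((le_abs_self _).trans hω)

theorem eLpNorm_sqrt_two [IsProbabilityMeasure μ] {g : Ω → ℝ} (hg : MemLp g ∞ μ) (hnn : ∀ ω, 0 ≤ g ω) :
    eLpNorm (fun ω => √(g ω)) 2 μ = ENNReal.ofReal √(∫ ω, g ω ∂μ) := by
  have hm : MemLp (fun ω => √(g ω)) 2 μ := (memLp_sqrt_top hg).mono_exponent le_top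
  rw [hm.eLpNorm_eq_integral_rpow_norm (by norm_num) (by norm_num), Real.sqrt_eq_rpow]
  congr 2
  · refine integral_congr_ae (ae_of_all _ fun ω => ?_)
    simp [Real.sq_sqrt (hnn ω)]
  · simp

theorem IsBddFun.memLp_trace {F : Ω → Matrix (Fin 2) (Fin 2) ℂ} (hF : IsBddFun μ F) :
    MemLp (fun ω => ((F ω)ᴴ * F ω).trace.re) ∞ μ := by
  simp only [Matrix.trace_fin_two]
  have h := hF.conjTranspose.mul hF
  exact ((h 0 0).add (h 1 1)).re

theorem trace_conjTranspose_mul_self_nonneg (A : Matrix (Fin 2) (Fin 2) ℂ) :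
    0 ≤ (Aᴴ * A).trace.re :=
  (Complex.le_def.1 (Matrix.posSemidef_conjTranspose_mul_self A).trace_nonneg).1

theorem matLpNorm_two [IsProbabilityMeasure μ] {F : Ω → Matrix (Fin 2) (Fin 2) ℂ} (hF : IsBddFun μ F) :
    matLpNorm μ 2 F = ENNReal.ofReal √(normSqL2 μ F) := by
  rw [matLpNorm, normSqL2,
    ← eLpNorm_sqrt_two hF.memLp_trace fun ω => trace_conjTranspose_mul_self_nonneg _]
  simp only [schattenNorm_two]

/-- In rank at most one the Schatten exponent is immaterial, and `L_p` norms increase with `p` on a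
probability space. This reduces the Pisier norm to Hilbert–Schmidt computations. -/
theorem le_matLpNorm_of_det_eq_zero [IsProbabilityMeasure μ] {F : Ω → Matrix (Fin 2) (Fin 2) ℂ} (hF : IsBddFun μ F)
    (hdet : ∀ᵐ ω ∂μ, (F ω).det = 0) {p : ℝ≥0∞} (hp : 2 ≤ p) :
    ENNReal.ofReal √(normSqL2 μ F) ≤ matLpNorm μ p F := by
  rw [normSqL2, ← eLpNorm_sqrt_two hF.memLp_trace fun ω => trace_conjTranspose_mul_self_nonneg _]
  refine (eLpNorm_le_eLpNorm_of_exponent_le hp (memLp_sqrt_top hF.memLp_trace).1).trans ?_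
  refine eLpNorm_mono_ae ?_
  filter_upwards [hdet] with ω hω
  rw [Real.norm_of_nonneg (Real.sqrt_nonneg _)]
  exact (sqrt_trace_le_schattenNorm (le_trans (by norm_num) hp) hω).trans (le_abs_self _)

/-- With a single nonzero row, the left factor contributes only the scalar `(X* X)₀₀`. -/
theorem trace_sqAbs_conj_row (X Y : Matrix (Fin 2) (Fin 2) ℂ) (z : ℂ) :
    ((X * !![1, z; 0, 0] * Y)ᴴ * (X * !![1, z; 0, 0] * Y)).trace =
      (Xᴴ * X) 0 0 * ((Y * Yᴴ) 0 0 + (z * (Y * Yᴴ) 1 0 + star z * (Y * Yᴴ) 0 1) +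
        ((‖z‖ ^ 2 : ℝ) : ℂ) * (Y * Yᴴ) 1 1) := by
  rw [← Complex.normSq_eq_norm_sq, Complex.normSq_eq_conj_mul_self]
  simp [Matrix.trace_fin_two, Matrix.mul_apply, Fin.sum_univ_two]
  ring

/-- Mean zero kills the terms linear in `u`, leaving `c · tr (ρ Y Y*)` with `ρ = diag(1, ε² ∫
|u|²)`. -/
theorem normSqL2_conj_rowFun [IsProbabilityMeasure μ] {u : Lp ℂ ∞ μ} (hu : ∫ ω, u ω ∂μ = 0) (ε : ℝ)
    (X Y : Matrix (Fin 2) (Fin 2) ℂ) {a b c : ℝ} (hX : (Xᴴ * X) 0 0 = (c : ℂ))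
    (h0 : (Y * Yᴴ) 0 0 = (a : ℂ)) (h1 : (Y * Yᴴ) 1 1 = (b : ℂ)) :
    normSqL2 μ (fun ω => X * (rowFun u ε).toFun ω * Y) =
      c * (a + (ε ^ 2 * ∫ ω, ‖u ω‖ ^ 2 ∂μ) * b) := by
  have hui := integrable_linf u
  have hc : Integrable (fun ω => star (u ω)) μ :=
    (integrable_linf (star u)).congr (Lp.coeFn_star u)
  have hsq : Integrable (fun ω => ((‖u ω‖ ^ 2 : ℝ) : ℂ)) μ := (integrable_norm_sq u).ofReal
  have e1 : normSqL2 μ (fun ω => X * (rowFun u ε).toFun ω * Y) =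
      ∫ ω, ((c : ℂ) * (a + (u ω * (ε * (Y * Yᴴ) 1 0) + star (u ω) * (ε * (Y * Yᴴ) 0 1)) +
        ((‖u ω‖ ^ 2 : ℝ) : ℂ) * ((ε ^ 2 * b : ℝ) : ℂ))).re ∂μ := by
    refine integral_congr_ae ?_
    filter_upwards [rowFun_toFun u ε] with ω hω
    rw [hω, trace_sqAbs_conj_row, hX, h0, h1, norm_mul, mul_pow]
    congr 1
    simp only [Complex.norm_real, Real.norm_eq_abs, sq_abs, Complex.star_def, map_mul,
      Complex.conj_ofReal]
    push_cast
    ring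
  have i1 : Integrable (fun ω => u ω * (ε * (Y * Yᴴ) 1 0) + star (u ω) * (ε * (Y * Yᴴ) 0 1)) μ :=
    (hui.mul_const _).add (hc.mul_const _)
  have i2 : Integrable (fun ω => (a : ℂ) +
      (u ω * (ε * (Y * Yᴴ) 1 0) + star (u ω) * (ε * (Y * Yᴴ) 0 1))) μ :=
    (integrable_const _).add i1
  have i3 := hsq.mul_const ((ε ^ 2 * b : ℝ) : ℂ)
  have hu' : ∫ ω, star (u ω) ∂μ = 0 := by
    have := integral_conj (μ := μ) (f := u)
    rw [hu, map_zero] at this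
    exact this
  have e2 := integral_re ((i2.add i3).const_mul (c : ℂ))
  simp only [Pi.add_apply, RCLike.re_to_complex] at e2
  rw [e1, e2, integral_const_mul, integral_add i2 i3, integral_add (integrable_const _) i1,
    integral_add (hui.mul_const _) (hc.mul_const _), integral_mul_const, integral_mul_const,
    integral_mul_const, hu, hu', integral_complex_ofReal, integral_const]
  simp only [zero_mul, add_zero, probReal_univ, one_smul]
  norm_cast
  ring

theorem normSqL2_rowFun [IsProbabilityMeasure μ] {u : Lp ℂ ∞ μ} (hu : ∫ ω, u ω ∂μ = 0) (ε : ℝ) :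
    normSqL2 μ (rowFun u ε).toFun = 1 + ε ^ 2 * ∫ ω, ‖u ω‖ ^ 2 ∂μ := by
  have := normSqL2_conj_rowFun hu ε 1 1 (a := 1) (b := 1) (c := 1) (by simp) (by simp) (by simp)
  simpa using this

theorem pisierExponent_toReal {p : ℝ} (hp : 2 < p) :
    0 < (pisierExponent p).toReal ∧ 1 ≤ (pisierExponent p).toReal / 2 := by
  have h1 : 0 < 1 / p := by positivity
  have h2 : 1 / p < 1 / 2 := by gcongr
  have h3 : 0 < (1 / 2 - 1 / p) / 2 := by linarith
  have h4 : (pisierExponent p).toReal = ((1 / 2 - 1 / p) / 2)⁻¹ := by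
    rw [pisierExponent, ENNReal.toReal_inv, ENNReal.toReal_ofReal h3.le]
  rw [h4]
  refine ⟨by positivity, ?_⟩
  have h5 : 2 ≤ ((1 / 2 - 1 / p) / 2)⁻¹ := by
    rw [le_inv_comm₀ (by norm_num) h3]; linarith
  linarith

/-- The Pisier norm of `e₁₁ + ε u e₁₂` grows faster than `ε²`. -/
theorem exists_le_pisierNorm_rowFun [IsProbabilityMeasure μ] {p K : ℝ} (hp : 2 < p) (hK : 0 < K) : ∃ η : ℝ, 0 < η ∧
    ∀ (u : Lp ℂ ∞ μ) (ε : ℝ), ∫ ω, u ω ∂μ = 0 →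
      ENNReal.ofReal √(1 + min (K * (ε ^ 2 * ∫ ω, ‖u ω‖ ^ 2 ∂μ)) η) ≤
        pisierNorm μ p (rowFun u ε).toFun := by
  obtain ⟨hP0, hP1⟩ := pisierExponent_toReal hp
  obtain ⟨η, hη, hgap⟩ := exists_gap hP1 hK
  refine ⟨η, hη, fun u ε hu => ?_⟩
  refine le_iInf fun x => le_iInf fun y => le_iInf fun hx => le_iInf fun hy => ?_
  obtain ⟨a, b, d, e, ha, hb, hd, he, hsum, hprod, h1, hx00, -⟩ := exists_inv_diag hP0 hx.1 hx.2
  obtain ⟨a', b', d', e', ha', hb', hd', he', hsum', hprod', h1', hy00, hy11⟩ :=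
    exists_inv_diag hP0 hy.1 hy.2
  have hxx : (x⁻¹)ᴴ * x⁻¹ = (xᴴ * x)⁻¹ := by
    rw [Matrix.conjTranspose_nonsing_inv, hx.1.isHermitian.eq, Matrix.mul_inv_rev]
  have hyy : y⁻¹ * (y⁻¹)ᴴ = (yᴴ * y)⁻¹ := by
    rw [Matrix.conjTranspose_nonsing_inv, hy.1.isHermitian.eq, Matrix.mul_inv_rev]
  have hF : IsBddFun μ fun ω => x⁻¹ * (rowFun u ε).toFun ω * y⁻¹ :=
    ((isBddFun_const _).mul (isBddFun_toFun _)).mul (isBddFun_const _)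
  refine le_trans ?_ (le_matLpNorm_of_det_eq_zero hF ?_ ?_)
  · rw [normSqL2_conj_rowFun hu ε _ _ ((congrFun (congrFun hxx 0) 0).trans hx00)
      ((congrFun (congrFun hyy 0) 0).trans hy00) ((congrFun (congrFun hyy 1) 1).trans hy11)]
    refine ENNReal.ofReal_le_ofReal (Real.sqrt_le_sqrt ?_)
    have hs : 0 ≤ ε ^ 2 * ∫ ω, ‖u ω‖ ^ 2 ∂μ :=
      mul_nonneg (sq_nonneg _) (integral_nonneg fun ω => by positivity)
    refine (hgap a' b' d' e' _ ha' hb' hd' he' hs hsum' hprod' h1').trans ?_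
    refine le_mul_of_one_le_left (by positivity) ?_
    exact (one_le_diag_inv hP1 ha hd he hsum hprod h1).1
  · filter_upwards [rowFun_toFun u ε] with ω hω
    rw [hω, Matrix.det_mul, Matrix.det_mul, Matrix.det_fin_two_of]
    simp
  · rw [← ENNReal.ofReal_ofNat]
    exact ENNReal.ofReal_le_ofReal hp.le

theorem pisierNorm_two_le (F : Ω → Matrix (Fin 2) (Fin 2) ℂ) :
    pisierNorm μ 2 F ≤ matLpNorm μ 2 F := by
  have h1 : schattenNorm (pisierExponent 2) 1 = 1 := by
    have : pisierExponent 2 = ∞ := by simp [pisierExponent]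
    rw [this, schattenNorm_top_one]
  refine (iInf₂_le 1 1).trans ((iInf₂_le ⟨Matrix.PosDef.one, h1⟩ ⟨Matrix.PosDef.one, h1⟩).trans ?_)
  simp

namespace SymmetricMarkovSemigroup

variable [IsProbabilityMeasure μ] (S : SymmetricMarkovSemigroup μ)

theorem normSqL2_toFun (f : MatLinf μ) :
    normSqL2 μ f.toFun = ∑ j, ∑ i, ∫ ω, ‖f i j ω‖ ^ 2 ∂μ := by
  have h1 : ∀ ω, ((f.toFun ω)ᴴ * f.toFun ω).trace.re = ∑ j, ∑ i, ‖f i j ω‖ ^ 2 := by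
    intro ω
    simp only [Matrix.trace, Matrix.diag, Matrix.mul_apply, Matrix.conjTranspose_apply,
      MatLinf.toFun, Matrix.of_apply, Complex.re_sum, Complex.star_def]
    refine Finset.sum_congr rfl fun j _ => Finset.sum_congr rfl fun i _ => ?_
    rw [Complex.conj_mul']
    norm_cast
  simp only [normSqL2, h1]
  rw [integral_finsetSum _ fun j _ => integrable_finsetSum _ fun i _ => integrable_norm_sq _]
  exact Finset.sum_congr rfl fun j _ => integral_finsetSum _ fun i _ => integrable_norm_sq _

theorem hypercontractive_zero (C : Set (MatLinf μ)) : S.Hypercontractive C 0 := by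
  refine ⟨le_rfl, fun f _ t => ?_⟩
  have h2 : 1 + Real.exp (2 * 0 * t) = 2 := by norm_num
  rw [h2]
  refine (pisierNorm_two_le _).trans ?_
  rw [matLpNorm_two (isBddFun_toFun _), matLpNorm_two (isBddFun_toFun _), normSqL2_toFun,
    normSqL2_toFun]
  refine ENNReal.ofReal_le_ofReal (Real.sqrt_le_sqrt ?_)
  refine Finset.sum_le_sum fun j _ => Finset.sum_le_sum fun i _ => ?_
  exact S.integral_T_sq_le t (f i j)

theorem hypercontractive_nonpos {C : Set (MatLinf μ)} {u : Lp ℂ ∞ μ} (hu : ∫ ω, u ω ∂μ = 0)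
    (hs : 0 < ∫ ω, ‖u ω‖ ^ 2 ∂μ) (hC : ∀ ε, rowFun u ε ∈ C) {α : ℝ}
    (h : S.Hypercontractive C α) : α ≤ 0 := by
  by_contra! hα
  obtain ⟨t, ht, hTs⟩ := S.exists_pos_integral_T_sq_pos u hs
  have hp : 2 < 1 + Real.exp (2 * α * t) := by
    have : 1 < Real.exp (2 * α * t) := Real.one_lt_exp_iff.2 (by positivity)
    linarith
  obtain ⟨η, hη, hlow⟩ := exists_le_pisierNorm_rowFun (μ := μ) hp
    -- This `K` compensates the loss from `‖u‖_2` to `‖T_t u‖_2` and gains a factor `2`: `K ε² ‖T_t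
    -- u‖_2² = 2 ε² ‖u‖_2²`.
    (K := 2 * (∫ ω, ‖u ω‖ ^ 2 ∂μ) / ∫ ω, ‖S.T t u ω‖ ^ 2 ∂μ) (by positivity)
  -- Both entries of the minimum become `η`, so the inequality would read `1 + η ≤ 1 + η/2`.
  let ε : ℝ := √(η / 2 / ∫ ω, ‖u ω‖ ^ 2 ∂μ)
  have hε : ε ^ 2 = η / 2 / ∫ ω, ‖u ω‖ ^ 2 ∂μ := Real.sq_sqrt (by positivity)
  have h1 := hlow (S.T t u) ε ((S.integral_T t u).trans hu)
  have h2 := h.2 _ (hC ε) t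
  rw [S.amp_rowFun, matLpNorm_two (isBddFun_toFun _), normSqL2_rowFun hu] at h2
  have h3 := h1.trans h2
  have e1 : 2 * (∫ ω, ‖u ω‖ ^ 2 ∂μ) / (∫ ω, ‖S.T t u ω‖ ^ 2 ∂μ) *
      (ε ^ 2 * ∫ ω, ‖S.T t u ω‖ ^ 2 ∂μ) = η := by
    rw [hε]; field_simp
  have e2 : ε ^ 2 * ∫ ω, ‖u ω‖ ^ 2 ∂μ = η / 2 := by
    rw [hε]; field_simp
  rw [e1, e2, min_self, ENNReal.ofReal_le_ofReal_iff (Real.sqrt_nonneg _),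
    Real.sqrt_le_sqrt_iff (by positivity)] at h3
  linarith

end SymmetricMarkovSemigroup

end Norms

end MatrixLSI

end

theorem mainTheorem7 {Ω : Type*} [MeasurableSpace Ω] (μ : MeasureTheory.Measure Ω)
    [MeasureTheory.IsProbabilityMeasure μ]
    (hμ : ∃ X : Set Ω, MeasurableSet X ∧ 0 < μ X ∧ μ X < 1)
    (S : MatrixLSI.SymmetricMarkovSemigroup μ) (hS : S.IsErgodic) :
    (IsGreatest {α : ℝ | S.Rothaus S.dirichletAlgebra α} 0 ∧
      IsGreatest {α : ℝ | S.LogSobolevForm α} 0 ∧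
      IsGreatest {α : ℝ | S.Hypercontractive S.dirichletAlgebra α} 0) ∧
    (IsGreatest {α : ℝ | S.Rothaus S.matDom α} 0 ∧
      IsGreatest {α : ℝ | S.LogSobolevGen α} 0 ∧
      IsGreatest {α : ℝ | S.Hypercontractive S.matDom α} 0) := by
  obtain ⟨u, g, hg, hu, hs, B, hB⟩ := S.exists_mean_zero_mem_dom hμ
  have hform : ∀ ε, MatrixLSI.rowFun u ε ∈ S.dirichletAlgebra := fun ε =>
    (S.energy_rowFun_le hB ε).trans_lt ENNReal.ofReal_lt_top
  have hdom : ∀ ε, MatrixLSI.rowFun u ε ∈ S.matDom := fun ε =>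
    ⟨_, S.isMatGenerator_rowFun hg ε⟩
  exact ⟨⟨⟨S.rothaus_zero _, fun _ h => S.rothaus_nonpos hu hs hform h⟩,
    ⟨S.logSobolevForm_zero, fun _ h => S.logSobolevForm_nonpos hu hs hB h⟩,
    ⟨S.hypercontractive_zero _, fun _ h => S.hypercontractive_nonpos hu hs hform h⟩⟩,
    ⟨⟨S.rothaus_zero _, fun _ h => S.rothaus_nonpos hu hs hdom h⟩,
    ⟨S.logSobolevGen_zero, fun _ h => S.logSobolevGen_nonpos hu hs hg h⟩,
    ⟨S.hypercontractive_zero _, fun _ h => S.hypercontractive_nonpos hu hs hdom h⟩⟩⟩
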